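/- Setting. Let $m\ge 2$, let $\mathcal G$ be a connected undirected graph on $\{1,\dots,m\}$ with Laplacian matrix $L$, and let $\mathbf L=L\otimes I_d$ act on $\mathbb R^{md}$. For each agent $i$ let $X_i\subseteq\mathbb R^d$ be closed and convex, $\|\cdot\|_{X_i}$ a norm on $\mathbb R^d$ with dual norm $\|\cdot\|_{*}$, and $\omega_i:X_i\to\mathbb R$ continuously differentiable and strongly convex with modulus $1$, i.e. $\langle\nabla\omega_i(x)-\nabla\omega_i(u),x-u\rangle\ge\|x-u\|_{X_i}^2$ on $X_i$; put $V_i(x,u)=\omega_i(u)-\omega_i(x)-\langle\nabla\omega_i(x),u-x\rangle$. Let $f_i:X_i\to\mathbb R$ be convex with a choice of subgradients $f_i'(y)\in\partial f_i(y)$ such that $0\le f_i(x)-f_i(y)-\langle f_i'(y),x-y\rangle\le M\|x-y\|_{X_i}$ for all $x,y\in X_i$, where $M>0$. On $\mathbb R^{md}$, $\|\cdot\|$ is the Euclidean norm, and $\|\mathbf L\|=\max\{\|\mathbf L\mathbf x\|:\sum_i\|x_i\|_{X_i}^2\le1\}$. Let $F(\mathbf x)=\sum_i f_i(x_i)$,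 and let $\mathbf x^*$ be an optimal solution of $\min\{F(\mathbf x):\mathbf L\mathbf x=0,\ x_i\in X_i\ \forall i\}$. Assume that the maxima $\bar V_i(x_i^*)=\max_{x_i\in X_i}V_i(x_i,x_i^*)$ exist and that $\bar{\mathbf V}(\mathbf x^*)=\sum_i\bar V_i(x_i^*)>0$. Stochastic oracle. Fix $\sigma>0$. The $t$-th call ($t\ge0$) of agent $i$ in outer iteration $k$, with query point $u$, returns $G_i(u,\xi_i^{t,k})$, where $\xi_i^{t,k}$ is independent of the random inputs of all earlier calls of all agents (those with lexicographically smaller $(k,t)$), and for every $u\in X_i$: $\mathbb E[G_i(u,\xi_i^{t,k})]=f_i'(u)$, $\mathbb E\|G_i(u,\xi_i^{t,k})-f_i'(u)\|_*^2\le\sigma^2$, $\mathbb E\exp\{\|G_i(u,\xi_i^{t,k})-f_i'(u)\|_*^2/\sigma^2\}\le e$. Algorithm (SDCS). Let $N\ge1$, $\mathbf x^{-1}=\mathbf x^0=\hat{\mathbf x}^0\in X_1\times\dots\times X_m$ and $\mathbf y^0\in\mathbb R^{md}$ be given. For $k=1,\dots,N$ put $\tilde{\mathbf x}^k=\alpha_k(\hat{\mathbf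 x}^{k-1}-\mathbf x^{k-2})+\mathbf x^{k-1}$, $\mathbf y^k=\mathbf y^{k-1}+\tau_k^{-1}\mathbf L\tilde{\mathbf x}^k$, $\mathbf w^k=\mathbf L\mathbf y^k$; then every agent $i$ sets $u_i^0=x_i^{k-1}$ and, for $t=1,\dots,T_k$, $u_i^t=\operatorname{argmin}_{u\in X_i}\ \langle w_i^k+G_i(u_i^{t-1},\xi_i^{t-1,k}),u\rangle+\eta_kV_i(x_i^{k-1},u)+\eta_k\beta_tV_i(u_i^{t-1},u)$, and $x_i^k=u_i^{T_k}$, $\hat x_i^k=(\sum_{t=1}^{T_k}\lambda_t)^{-1}\sum_{t=1}^{T_k}\lambda_tu_i^t$. The parameters are $\lambda_t=t+1$, $\beta_t=t/2$, $\alpha_k=1$, $\eta_k=2\|\mathbf L\|$, $\tau_k=\|\mathbf L\|$, $T_k=\big\lceil m(M^2+\sigma^2)N/(\|\mathbf L\|^2\,\bar{\mathbf V}(\mathbf x^*))\big\rceil$. Let $\hat{\mathbf x}^N_{\rm av}=\frac1N\sum_{k=1}^N\hat{\mathbf x}^k$. Claim. For every $\zeta>0$, $$\mathrm{Prob}\Big\{F(\hat{\mathbf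 x}^N_{\rm av})-F(\mathbf x^*)\ge\tfrac{\|\mathbf L\|}{N}\big[(7+8\zeta)\bar{\mathbf V}(\mathbf x^*)+\tfrac12\|\mathbf y^0\|^2\big]\Big\}\le e^{-\zeta^2/3}+e^{-\zeta},$$ and, for every $\mathbf y^*\in\mathbb R^{md}$ such that $(\mathbf x^*,\mathbf y^*)$ is a saddle point of $F(\mathbf x)+\langle\mathbf L\mathbf x,\mathbf y\rangle$ (minimum over $\mathbf x\in X_1\times\dots\times X_m$, maximum over $\mathbf y\in\mathbb R^{md}$), $$\mathrm{Prob}\Big\{\|\mathbf L\hat{\mathbf x}^N_{\rm av}\|^2\ge\tfrac{18\|\mathbf L\|^2}{N^2}\big[(7+8\zeta)\bar{\mathbf V}(\mathbf x^*)+\tfrac23\|\mathbf y^*-\mathbf y^0\|^2\big]\Big\}\le e^{-\zeta^2/3}+e^{-\zeta}.$$ -/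

import Mathlib

open MeasureTheory ProbabilityTheory

namespace SDCS

/-- The decision space `ℝ^d` of one agent. -/
abbrev Vec (d : ℕ) : Type := EuclideanSpace ℝ (Fin d)

/-- Stacked vectors `(x_1, …, x_m) ∈ ℝ^{md}`, with the Euclidean norm of `ℝ^{md}`. -/
abbrev Stack (m d : ℕ) : Type := PiLp 2 (fun _ : Fin m => Vec d)

/-- The dual of the norm `p` on `ℝ^d`: `p_*(g) = sup {⟨g, x⟩ : p x ≤ 1}`. -/
noncomputable def dualNorm {d : ℕ} (p : Seminorm ℝ (Vec d)) (g : Vec d) : ℝ :=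
  sSup ((fun x : Vec d => inner ℝ g x) '' {x | p x ≤ 1})

/-- The operator `𝐋 = L ⊗ I_d`, `L` being the graph Laplacian: `(𝐋 x)_i = ∑ j, L_{ij} x_j`. -/
noncomputable def lap {m d : ℕ} (Γ : SimpleGraph (Fin m)) [DecidableRel Γ.Adj]
    (x : Stack m d) : Stack m d :=
  WithLp.toLp 2 (fun i => ∑ j, Γ.lapMatrix ℝ i j • x j)

/-- The operator norm `‖𝐋‖` from `ℝ^{md}` with the primal norm `(∑ i, p_i(x_i)^2)^{1/2}` to
`ℝ^{md}` with the Euclidean norm. It is the spectral norm if all `p_i` are Euclidean. -/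
noncomputable def lapNorm {m d : ℕ} (Γ : SimpleGraph (Fin m)) [DecidableRel Γ.Adj]
    (p : Fin m → Seminorm ℝ (Vec d)) : ℝ :=
  sSup ((fun x : Stack m d => ‖lap Γ x‖) '' {x | ∑ i, p i (x i) ^ 2 ≤ 1})

/-- `φ` is a distance generating function on `U` with modulus `1` with respect to the norm `p`:
it is continuously differentiable on `U` with gradient `gφ`, and strongly convex. -/
structure IsDistanceGenerating {d : ℕ} (U : Set (Vec d)) (p : Seminorm ℝ (Vec d))
    (φ : Vec d → ℝ) (gφ : Vec d → Vec d) : Prop where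
  hasGradient : ∀ x ∈ U, HasFDerivWithinAt φ (innerSL ℝ (gφ x)) U x
  continuousOn_gradient : ContinuousOn gφ U
  strongly_convex : ∀ x ∈ U, ∀ u ∈ U, p (x - u) ^ 2 ≤ inner ℝ (gφ x - gφ u) (x - u)

/-- The prox-function (Bregman distance)
`V(x, u) = φ(u) - [φ(x) + ⟨∇φ(x), u - x⟩]`; the base point is the first argument. -/
noncomputable def prox {d : ℕ} (φ : Vec d → ℝ) (gφ : Vec d → Vec d) (x u : Vec d) : ℝ :=
  φ u - (φ x + inner ℝ (gφ x) (u - x))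

/-- The objective `F(x) = ∑ i, f_i(x_i)`. -/
def obj {m d : ℕ} (f : Fin m → Vec d → ℝ) (x : Stack m d) : ℝ := ∑ i, f i (x i)

/-- `xs` is an optimal solution of `min F(x)` subject to `𝐋 x = 0`, `x_i ∈ X_i`. -/
structure IsOptimal {m d : ℕ} (Γ : SimpleGraph (Fin m)) [DecidableRel Γ.Adj]
    (X : Fin m → Set (Vec d)) (f : Fin m → Vec d → ℝ) (xs : Stack m d) : Prop where
  mem : ∀ i, xs i ∈ X i
  feasible : lap Γ xs = 0
  le : ∀ x : Stack m d, (∀ i, x i ∈ X i) → lap Γ x = 0 → obj f xs ≤ obj f x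

/-- `(xs, ys)` is a saddle point of `F(x) + ⟨𝐋 x, y⟩` over `x ∈ X_1 × ⋯ × X_m`,
`y ∈ ℝ^{md}` (minimum in `x`, maximum in `y`). -/
structure IsSaddle {m d : ℕ} (Γ : SimpleGraph (Fin m)) [DecidableRel Γ.Adj]
    (X : Fin m → Set (Vec d)) (f : Fin m → Vec d → ℝ) (xs ys : Stack m d) : Prop where
  mem : ∀ i, xs i ∈ X i
  max : ∀ y : Stack m d, obj f xs + inner ℝ (lap Γ xs) y ≤ obj f xs + inner ℝ (lap Γ xs) ys
  min : ∀ x : Stack m d, (∀ i, x i ∈ X i) →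
    obj f xs + inner ℝ (lap Γ xs) ys ≤ obj f x + inner ℝ (lap Γ x) ys

/-- One call `(xout, xhat) = CS(U, V, T, η, w, xin)` of the communication sliding procedure, with
inner iterates `u 0, …, u T`, weights `lam t` and parameters `β t`. The vector that the oracle
returns at inner iteration `t + 1`, for the query point `z = u t`, is `H t z`. -/
structure IsCS {d : ℕ} (U : Set (Vec d)) (φ : Vec d → ℝ) (gφ : Vec d → Vec d)
    (lam β : ℕ → ℝ) (T : ℕ) (η : ℝ) (H : ℕ → Vec d → Vec d) (w xin : Vec d)
    (u : ℕ → Vec d) (xout xhat : Vec d) : Prop where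
  init : u 0 = xin
  mem : ∀ t < T, u (t + 1) ∈ U
  step : ∀ t < T, IsMinOn (fun z => inner ℝ (w + H t (u t)) z + η * prox φ gφ xin z
    + η * β (t + 1) * prox φ gφ (u t) z) U (u (t + 1))
  out : xout = u T
  hat : xhat = (∑ t ∈ Finset.Icc 1 T, lam t)⁻¹ • ∑ t ∈ Finset.Icc 1 T, lam t • u t

/-- The prediction of outer iteration `k + 1`:
`α_{k+1} (xhat^k - x^{k-1}) + x^k`, where `x^{-1} = x^0` (natural subtraction gives `0 - 1 = 0`). -/
noncomputable def predict {m d : ℕ} (α : ℕ → ℝ) (x xhat : ℕ → Stack m d) (k : ℕ) : Stack m d :=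
  α (k + 1) • (xhat k - x (k - 1)) + x k

/-- `N` outer iterations of the stochastic decentralized communication sliding method.
`H i k t z` is the vector returned by the oracle of agent `i` at inner iteration `t + 1` of outer
iteration `k` for the query point `z`; `u i k` are the inner iterates of agent `i` there. -/
structure IsRun {m d : ℕ} (Γ : SimpleGraph (Fin m)) [DecidableRel Γ.Adj]
    (X : Fin m → Set (Vec d)) (φ : Fin m → Vec d → ℝ) (gφ : Fin m → Vec d → Vec d)
    (α η τ : ℕ → ℝ) (T : ℕ → ℕ) (lam β : ℕ → ℝ) (N : ℕ)
    (H : Fin m → ℕ → ℕ → Vec d → Vec d) (x0 y0 : Stack m d)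
    (x xhat y : ℕ → Stack m d) (u : Fin m → ℕ → ℕ → Vec d) : Prop where
  init_x : x 0 = x0
  init_hat : xhat 0 = x0
  init_y : y 0 = y0
  dual : ∀ k < N, y (k + 1) = y k + (1 / τ (k + 1)) • lap Γ (predict α x xhat k)
  primal : ∀ k < N, ∀ i, IsCS (X i) (φ i) (gφ i) lam β (T (k + 1)) (η (k + 1)) (H i (k + 1))
    (lap Γ (y (k + 1)) i) (x k i) (u i (k + 1)) (x (k + 1) i) (xhat (k + 1) i)

/-- The information generated by all oracle calls of all agents made before the calls with index
`(k, t)`, where outer iterations are `1, 2, …` and inner calls `0, …, T - 1`, in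
lexicographic order. -/
abbrev past {m : ℕ} {Ω : Type*} {Ξ : Fin m → Type*} [∀ i, MeasurableSpace (Ξ i)]
    (ξ : ∀ i : Fin m, ℕ → ℕ → Ω → Ξ i) (T : ℕ → ℕ) (k t : ℕ) : MeasurableSpace Ω :=
  ⨆ (j : Fin m) (a : ℕ) (b : ℕ)
    (_ : (1 ≤ a ∧ b < T a) ∧ (a < k ∨ (a = k ∧ b < t))),
    MeasurableSpace.comap (ξ j a b) inferInstance

/-- The stochastic oracle `G i` of agent `i` with random inputs `ξ i k t` (call `t` of outer
iteration `k`, `1 ≤ k ≤ N`, `t < T k`): fresh randomness, unbiasedness, variance bound `σ^2` and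
light tails at every query point of `X i`. -/
structure IsOracle {m d : ℕ} {Ω : Type*} [MeasurableSpace Ω] (P : Measure Ω)
    {Ξ : Fin m → Type*} [∀ i, MeasurableSpace (Ξ i)]
    (X : Fin m → Set (Vec d)) (p : Fin m → Seminorm ℝ (Vec d)) (f' : Fin m → Vec d → Vec d)
    (σ : ℝ) (N : ℕ) (T : ℕ → ℕ)
    (G : ∀ i : Fin m, Vec d → Ξ i → Vec d) (ξ : ∀ i : Fin m, ℕ → ℕ → Ω → Ξ i) : Prop where
  measurable_oracle : ∀ i, Measurable (Function.uncurry (G i))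
  measurable_input : ∀ i k t, Measurable (ξ i k t)
  indep : ∀ i, ∀ k ∈ Finset.Icc 1 N, ∀ t < T k,
    Indep (MeasurableSpace.comap (ξ i k t) inferInstance) (past ξ T k t) P
  integrable : ∀ i, ∀ k ∈ Finset.Icc 1 N, ∀ t < T k, ∀ z ∈ X i,
    Integrable (fun s => G i z (ξ i k t s)) P
  unbiased : ∀ i, ∀ k ∈ Finset.Icc 1 N, ∀ t < T k, ∀ z ∈ X i,
    ∫ s, G i z (ξ i k t s) ∂P = f' i z
  variance : ∀ i, ∀ k ∈ Finset.Icc 1 N, ∀ t < T k, ∀ z ∈ X i,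
    ∫⁻ s, ENNReal.ofReal (dualNorm (p i) (G i z (ξ i k t s) - f' i z) ^ 2) ∂P
      ≤ ENNReal.ofReal (σ ^ 2)
  light_tail : ∀ i, ∀ k ∈ Finset.Icc 1 N, ∀ t < T k, ∀ z ∈ X i,
    ∫⁻ s, ENNReal.ofReal
      (Real.exp (dualNorm (p i) (G i z (ξ i k t s) - f' i z) ^ 2 / σ ^ 2)) ∂P
      ≤ ENNReal.ofReal (Real.exp 1)

end SDCS

/-! The argument is pathwise until its last stage. For each outcome, the Lagrangian gap of the
averaged iterate is bounded for all dual vectors `Y` at once, and the oracle errors δ = G - f' enter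
only through two sums: a weighted sum of ⟨δ, x* - u_t⟩ and a sum of ‖δ‖_*^2. Probability is needed
only to bound these two sums.

Inner loop (`prox_step_le`, `IsCS.le`). A prox-step satisfies a three-point inequality against any
comparison point z. Linearizing f at the query point u_t pairs δ with z - u_t, which is determined
before the call is made. The remainder, ⟨δ, u_{t+1} - u_t⟩ and the nonsmoothness M, is absorbed by
the strong convexity of the prox-term. The weights λ_t = t + 1 and β_t = t/2 make the prox-terms
telescope, and Jensen passes to the weighted average.

Outer loop (`IsRun.sum_gap_le`). The extrapolated dual step is handled by a potential made of the
dual distance, the prox-distance to x*, and a cross term with its compensating square. The potential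
drops by at least the gap minus the noise, and it stays nonnegative by completing a square.

Noise (`exists_bad_event`). Given the past, each linear error is centred and light-tailed, so its
exponential moments are sub-Gaussian (`lintegral_mul_exp_sum_le`). Errors of different agents in the
same round may be dependent, hence Cauchy–Schwarz over the agents, at the cost of a factor m.
Iterating over all calls and using Markov's inequality gives exp(-ζ^2/3). The squared errors need no
independence, only Jensen and Markov (`measure_sum_ge_le`), and give exp(-ζ). Conditioning requires
adapted iterates (`measurable_outer`), which holds because a prox-step is Lipschitz in its data.

The budget, in units of ‖𝐋‖ ∑ Vbar, is 3 for the initial prox-distance, 4(1 + ζ) for M^2 and the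
squared errors, and 4ζ for the linear errors: 7 + 8ζ in total. The exceptional event does not depend
on `Y`, so `Y` may be random: `Y = 0` yields the objective bound, and y* plus a multiple of 𝐋 x_av
yields the feasibility bound. -/

namespace SDCS

/-! ### Norms on ℝ^d and their duals -/

section Norms

variable {m d : ℕ}

/-- A norm on `ℝ^d` dominates a multiple of the Euclidean norm. -/
lemma exists_norm_le_mul (p : Seminorm ℝ (Vec d)) (hp : ∀ x, p x = 0 → x = 0) :
    ∃ C > 0, ∀ x, ‖x‖ ≤ C * p x := by
  have hc : Continuous p := by
    rw [← continuousOn_univ]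
    exact p.convexOn.continuousOn isOpen_univ
  -- The sphere is empty when `d = 0`; otherwise the constant is the inverse of the minimum of `p`
  -- on it.
  rcases (Metric.sphere (0 : Vec d) 1).eq_empty_or_nonempty with he | hne
  · refine ⟨1, one_pos, fun x => ?_⟩
    by_cases hx : x = 0
    · simp [hx]
    · exfalso
      have : ‖x‖⁻¹ • x ∈ Metric.sphere (0 : Vec d) 1 := by
        simp [norm_smul, inv_mul_cancel₀ (norm_ne_zero_iff.2 hx)]
      simp [he] at this
  · obtain ⟨z, hz, hmin⟩ := (isCompact_sphere (0 : Vec d) 1).exists_isMinOn hne hc.continuousOn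
    have hz0 : z ≠ 0 := by rintro rfl; simp at hz
    have hpz : 0 < p z := lt_of_le_of_ne (apply_nonneg p z) fun h => hz0 (hp z h.symm)
    refine ⟨(p z)⁻¹, inv_pos.2 hpz, fun x => ?_⟩
    by_cases hx : x = 0
    · simp [hx]
    · have hxn : 0 < ‖x‖ := norm_pos_iff.2 hx
      have h1 : p z ≤ p (‖x‖⁻¹ • x) := hmin (by
        simp [norm_smul, inv_mul_cancel₀ hxn.ne'])
      rw [map_smul_eq_mul, norm_inv, norm_norm, inv_mul_eq_div, le_div_iff₀ hxn] at h1
      rw [inv_mul_eq_div, le_div_iff₀ hpz]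
      linarith

/-- A real `sSup` is 0 on unbounded sets, so boundedness is what gives `dualNorm` its meaning. -/
lemma bddAbove_dual (p : Seminorm ℝ (Vec d)) (hp : ∀ x, p x = 0 → x = 0) (g : Vec d) :
    BddAbove ((fun x : Vec d => inner ℝ g x) '' {x | p x ≤ 1}) := by
  obtain ⟨C, hC, hle⟩ := exists_norm_le_mul p hp
  refine ⟨‖g‖ * C, ?_⟩
  rintro _ ⟨x, hx, rfl⟩
  calc inner ℝ g x ≤ ‖g‖ * ‖x‖ := real_inner_le_norm g x
    _ ≤ ‖g‖ * C := by
      gcongr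
      exact (hle x).trans (by simpa using mul_le_mul_of_nonneg_left hx hC.le)

lemma inner_le_dualNorm_mul (p : Seminorm ℝ (Vec d)) (hp : ∀ x, p x = 0 → x = 0)
    (g x : Vec d) : inner ℝ g x ≤ dualNorm p g * p x := by
  by_cases hx : p x = 0
  · simp [hp x hx]
  · have hpx : 0 < p x := lt_of_le_of_ne (apply_nonneg p x) (Ne.symm hx)
    have h : inner ℝ g ((p x)⁻¹ • x) ≤ dualNorm p g := by
      refine le_csSup (bddAbove_dual p hp g) ⟨(p x)⁻¹ • x, ?_, rfl⟩
      simp [map_smul_eq_mul, abs_of_pos hpx, inv_mul_cancel₀ hx]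
    rwa [inner_smul_right, inv_mul_eq_div, div_le_iff₀ hpx] at h

lemma abs_inner_le_dualNorm_mul (p : Seminorm ℝ (Vec d)) (hp : ∀ x, p x = 0 → x = 0)
    (g x : Vec d) : |inner ℝ g x| ≤ dualNorm p g * p x := by
  refine abs_le.2 ⟨?_, inner_le_dualNorm_mul p hp g x⟩
  have := inner_le_dualNorm_mul p hp g (-x)
  rw [inner_neg_right, map_neg_eq_map] at this
  linarith

/-- As a supremum of linear functionals the dual norm is lower semicontinuous: its sublevel sets are
intersections of closed half-spaces. -/
lemma measurable_dualNorm (p : Seminorm ℝ (Vec d)) (hp : ∀ x, p x = 0 → x = 0) :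
    Measurable (dualNorm p) := by
  refine measurable_of_Iic fun a => IsClosed.measurableSet ?_
  have : dualNorm p ⁻¹' Set.Iic a = ⋂ x ∈ {x | p x ≤ 1}, {g | inner ℝ g x ≤ a} := by
    ext g
    simp only [Set.mem_preimage, Set.mem_Iic, dualNorm, Set.mem_iInter, Set.mem_ofPred_eq]
    rw [csSup_le_iff (bddAbove_dual p hp g) ⟨_, 0, by simp, rfl⟩]
    simp
  rw [this]
  refine isClosed_biInter fun x _ => isClosed_le (by fun_prop) continuous_const

end Norms

/-! ### The operator 𝐋 and its norm -/

section Laplacian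

variable {m d : ℕ} (Γ : SimpleGraph (Fin m)) [DecidableRel Γ.Adj]

lemma lap_apply (x : Stack m d) (i : Fin m) :
    lap Γ x i = ∑ j, Γ.lapMatrix ℝ i j • x j := rfl

lemma lap_add (x y : Stack m d) : lap Γ (x + y) = lap Γ x + lap Γ y := by
  ext i : 1
  simp [lap_apply, smul_add, Finset.sum_add_distrib]

lemma lap_smul (c : ℝ) (x : Stack m d) : lap Γ (c • x) = c • lap Γ x := by
  ext i : 1
  simp only [lap_apply, PiLp.smul_apply, Finset.smul_sum, smul_smul, mul_comm]

/-- The operator `𝐋` as a linear map. -/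
noncomputable def lapHom : Stack m d →ₗ[ℝ] Stack m d where
  toFun := lap Γ
  map_add' := lap_add Γ
  map_smul' := lap_smul Γ

lemma lapHom_apply (x : Stack m d) : lapHom Γ x = lap Γ x := rfl

lemma lap_sub (x y : Stack m d) : lap Γ (x - y) = lap Γ x - lap Γ y :=
  map_sub (lapHom Γ) x y

lemma lap_zero : lap Γ (0 : Stack m d) = 0 := map_zero (lapHom Γ)

lemma inner_lap_left (x y : Stack m d) : inner ℝ (lap Γ x) y = inner ℝ x (lap Γ y) := by
  simp only [PiLp.inner_apply, lap_apply, sum_inner, inner_sum, inner_smul_left,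
    inner_smul_right]
  rw [Finset.sum_comm]
  refine Finset.sum_congr rfl fun i _ => Finset.sum_congr rfl fun j _ => ?_
  have := (Γ.isSymm_lapMatrix (R := ℝ)).apply i j
  simp [this]

variable (p : Fin m → Seminorm ℝ (Vec d))

/-- The primal norm `(∑ i, p_i(x_i)^2)^{1/2}` of a stacked vector. -/
noncomputable def stackNorm (x : Stack m d) : ℝ := √(∑ i, p i (x i) ^ 2)

lemma stackNorm_nonneg (x : Stack m d) : 0 ≤ stackNorm p x := Real.sqrt_nonneg _

lemma stackNorm_sq (x : Stack m d) : stackNorm p x ^ 2 = ∑ i, p i (x i) ^ 2 :=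
  Real.sq_sqrt (Finset.sum_nonneg fun _ _ => sq_nonneg _)

variable {p} (hp : ∀ i x, p i x = 0 → x = 0)
include hp

lemma bddAbove_lap :
    BddAbove ((fun x : Stack m d => ‖lap Γ x‖) '' {x | ∑ i, p i (x i) ^ 2 ≤ 1}) := by
  choose C hC hle using fun i => exists_norm_le_mul (p i) (hp i)
  refine ⟨√(∑ i, (∑ j, |Γ.lapMatrix ℝ i j| * C j) ^ 2), ?_⟩
  rintro _ ⟨x, hx, rfl⟩
  have hx' : ∀ j, ‖x j‖ ≤ C j := fun j => by
    have h1 : p j (x j) ^ 2 ≤ 1 :=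
      (Finset.single_le_sum (f := fun i => p i (x i) ^ 2) (fun _ _ => sq_nonneg _)
        (Finset.mem_univ j)).trans hx
    have h2 : p j (x j) ≤ 1 := (sq_le_one_iff₀ (apply_nonneg _ _)).1 h1
    exact (hle j _).trans (by simpa using mul_le_mul_of_nonneg_left h2 (hC j).le)
  dsimp only
  rw [PiLp.norm_eq_of_L2]
  refine Real.sqrt_le_sqrt (Finset.sum_le_sum fun i _ => ?_)
  gcongr
  rw [lap_apply]
  refine (norm_sum_le Finset.univ fun j => Γ.lapMatrix ℝ i j • x j).trans (Finset.sum_le_sum fun j _ => ?_)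
  rw [norm_smul, Real.norm_eq_abs]
  gcongr
  exact hx' j

lemma norm_lap_le (x : Stack m d) : ‖lap Γ x‖ ≤ lapNorm Γ p * stackNorm p x := by
  by_cases h : stackNorm p x = 0
  · have h0 : ∑ i, p i (x i) ^ 2 = 0 := by rw [← stackNorm_sq, h]; simp
    have hx : x = 0 := by
      ext i : 1
      refine hp i _ ?_
      have := (Finset.sum_eq_zero_iff_of_nonneg fun i _ => sq_nonneg (p i (x i))).1 h0 i
        (Finset.mem_univ i)
      simpa using this
    simp [hx, lap_zero, stackNorm]
  · have hpos : 0 < stackNorm p x := lt_of_le_of_ne (stackNorm_nonneg p x) (Ne.symm h)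
    have h1 : ‖lap Γ ((stackNorm p x)⁻¹ • x)‖ ≤ lapNorm Γ p := by
      refine le_csSup (bddAbove_lap Γ hp) ⟨(stackNorm p x)⁻¹ • x, ?_, rfl⟩
      have e : ∑ i, p i (((stackNorm p x)⁻¹ • x) i) ^ 2
          = (stackNorm p x)⁻¹ ^ 2 * ∑ i, p i (x i) ^ 2 := by
        rw [Finset.mul_sum]
        refine Finset.sum_congr rfl fun i _ => ?_
        rw [PiLp.smul_apply, map_smul_eq_mul, mul_pow, norm_inv, Real.norm_of_nonneg hpos.le]
      rw [Set.mem_ofPred_eq, e, ← stackNorm_sq, ← mul_pow, inv_mul_cancel₀ h, one_pow]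
    rwa [lap_smul, norm_smul, norm_inv, Real.norm_of_nonneg hpos.le, inv_mul_eq_div,
      div_le_iff₀ hpos] at h1

/-- Connectedness on at least two vertices gives every vertex a neighbour. A stacked vector
supported at one vertex is then mapped to one whose block there is degree times the original. -/
lemma lapNorm_pos (hm : 2 ≤ m) (hd : 0 < d) (hΓ : Γ.Connected) : 0 < lapNorm Γ p := by
  have : Nontrivial (Fin m) := Fin.nontrivial_iff_two_le.2 hm
  have : Nonempty (Fin d) := ⟨⟨0, hd⟩⟩
  obtain ⟨e, he⟩ := exists_ne (0 : Vec d)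
  let i : Fin m := ⟨0, by omega⟩
  let x : Stack m d := WithLp.toLp 2 (Pi.single i e)
  have hdeg : 0 < Γ.degree i := hΓ.preconnected.degree_pos_of_nontrivial i
  have hx : lap Γ x i = (Γ.degree i : ℝ) • e := by
    rw [lap_apply, Finset.sum_eq_single i]
    · simp [x, SimpleGraph.lapMatrix, SimpleGraph.degMatrix]
    · intro j _ hj
      simp [x, hj]
    · simp
  have hne : lap Γ x ≠ 0 := by
    intro h
    rw [h] at hx
    exact smul_ne_zero (Nat.cast_ne_zero.2 hdeg.ne') he hx.symm
  have h1 := norm_lap_le Γ hp x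
  have h2 : 0 < ‖lap Γ x‖ := norm_pos_iff.2 hne
  by_contra hcon
  have := mul_nonpos_of_nonpos_of_nonneg (not_lt.1 hcon) (stackNorm_nonneg p x)
  linarith

end Laplacian

/-! ### Bregman distances and prox-steps -/

section Bregman

variable {d : ℕ} {U : Set (Vec d)} {p : Seminorm ℝ (Vec d)} {φ : Vec d → ℝ}
  {gφ : Vec d → Vec d}

/-- A purely algebraic identity, valid for arbitrary `gφ`. -/
lemma prox_three_point (x u z : Vec d) :
    prox φ gφ x z = prox φ gφ x u + inner ℝ (gφ u - gφ x) (z - u) + prox φ gφ u z := by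
  have : z - x = (z - u) + (u - x) := by abel
  simp only [prox, this, inner_add_right, inner_sub_left]
  ring

lemma prox_self (x : Vec d) : prox φ gφ x x = 0 := by simp [prox]

/-- Strong convexity: the prox-function dominates half the squared norm. -/
lemma IsDistanceGenerating.half_sq_le_prox (h : IsDistanceGenerating U p φ gφ)
    (hU : Convex ℝ U) {x u : Vec d} (hx : x ∈ U) (hu : u ∈ U) :
    1 / 2 * p (u - x) ^ 2 ≤ prox φ gφ x u := by
  set v := u - x
  let c : ℝ → Vec d := fun s => x + s • v
  have hc : ∀ s ∈ Set.Icc (0 : ℝ) 1, c s ∈ U := fun s hs =>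
    hU.add_smul_sub_mem hx hu hs
  have hcd : ∀ s, HasDerivAt c v s := fun s => by
    have := ((hasDerivAt_id s).smul_const v).const_add x
    rwa [one_smul] at this
  -- Along the segment, the tangent term and the quadratic are subtracted from φ. Strong
  -- monotonicity of the gradient makes the difference nondecreasing, and `g 0 ≤ g 1` is the claim.
  let g : ℝ → ℝ := fun s => φ (c s) - s * inner ℝ (gφ x) v - s ^ 2 / 2 * p v ^ 2
  have hg : ∀ s ∈ Set.Icc (0 : ℝ) 1, HasDerivWithinAt g
      (inner ℝ (gφ (c s)) v - inner ℝ (gφ x) v - s * p v ^ 2) (Set.Icc 0 1) s := by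
    intro s hs
    have h1 : HasDerivWithinAt (φ ∘ c) (innerSL ℝ (gφ (c s)) v) (Set.Icc 0 1) s :=
      (h.hasGradient _ (hc s hs)).comp_hasDerivWithinAt s (hcd s).hasDerivWithinAt hc
    have h2 : HasDerivAt (fun s : ℝ => s * inner ℝ (gφ x) v) (inner ℝ (gφ x) v) s := by
      simpa using (hasDerivAt_id s).mul_const (inner ℝ (gφ x) v)
    have h3 : HasDerivAt (fun s : ℝ => s ^ 2 / 2 * p v ^ 2) (s * p v ^ 2) s := by
      have := ((hasDerivAt_pow 2 s).div_const 2).mul_const (p v ^ 2)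
      exact this.congr_deriv (by push_cast; ring)
    exact (h1.sub h2.hasDerivWithinAt).sub h3.hasDerivWithinAt
  have hmono : MonotoneOn g (Set.Icc 0 1) := by
    refine monotoneOn_of_hasDerivWithinAt_nonneg (convex_Icc 0 1)
      (f' := fun s => inner ℝ (gφ (c s)) v - inner ℝ (gφ x) v - s * p v ^ 2)
      (fun s hs => (hg s hs).continuousWithinAt)
      (fun s hs => (hg s (interior_subset hs)).mono interior_subset) fun s hs => ?_
    rw [interior_Icc] at hs
    have h1 := h.strongly_convex _ (hc s ⟨hs.1.le, hs.2.le⟩) _ hx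
    have h2 : c s - x = s • v := by simp [c]
    rw [h2, map_smul_eq_mul, inner_smul_right, inner_sub_left, Real.norm_of_nonneg hs.1.le] at h1
    have h3 : s * (s * p v ^ 2) ≤ s * (inner ℝ (gφ (c s)) v - inner ℝ (gφ x) v) := by
      linarith [h1]
    have := le_of_mul_le_mul_left h3 hs.1
    linarith
  have h01 := hmono (Set.left_mem_Icc.2 zero_le_one) (Set.right_mem_Icc.2 zero_le_one) zero_le_one
  have e0 : c 0 = x := by simp [c]
  have e1 : c 1 = u := by simp [c, v]
  simp only [g, e0, e1] at h01
  simp only [prox]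
  norm_num at h01
  linarith

lemma IsDistanceGenerating.prox_nonneg (h : IsDistanceGenerating U p φ gφ)
    (hU : Convex ℝ U) {x u : Vec d} (hx : x ∈ U) (hu : u ∈ U) : 0 ≤ prox φ gφ x u :=
  le_trans (by positivity) (h.half_sq_le_prox hU hx hu)

/-- The variational inequality that characterizes a prox-mapping step. -/
lemma IsDistanceGenerating.variational (h : IsDistanceGenerating U p φ gφ)
    (hU : Convex ℝ U) {c x u' u z : Vec d} {a b : ℝ} (hu : u ∈ U) (hz : z ∈ U)
    (hmin : IsMinOn (fun z => inner ℝ c z + a * prox φ gφ x z + b * prox φ gφ u' z) U u) :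
    0 ≤ inner ℝ (c + a • (gφ u - gφ x) + b • (gφ u - gφ u')) (z - u) := by
  have hprox : ∀ y : Vec d, HasFDerivWithinAt (prox φ gφ y) (innerSL ℝ (gφ u - gφ y)) U u := by
    intro y
    have h1 : HasFDerivWithinAt (fun z => φ y + inner ℝ (gφ y) (z - y))
        (innerSL ℝ (gφ y)) U u := by
      have := ((innerSL ℝ (gφ y)).hasFDerivWithinAt (s := U) (x := u)).add_const
        (φ y - inner ℝ (gφ y) y)
      refine this.congr_of_eventuallyEq (Filter.Eventually.of_forall fun z => ?_) ?_ <;>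
      · simp only [innerSL_apply_apply, inner_sub_right]
        ring
    have := (h.hasGradient u hu).sub h1
    rwa [← map_sub] at this
  have hd : HasFDerivWithinAt
      (fun z => inner ℝ c z + a * prox φ gφ x z + b * prox φ gφ u' z)
      (innerSL ℝ (c + a • (gφ u - gφ x) + b • (gφ u - gφ u'))) U u := by
    have := (((innerSL ℝ c).hasFDerivWithinAt (s := U) (x := u)).add
      ((hprox x).const_mul a)).add ((hprox u').const_mul b)
    rw [← map_smul, ← map_add, ← map_smul, ← map_add] at this
    exact this
  have := hmin.localize.hasFDerivWithinAt_nonneg hd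
    (sub_mem_posTangentConeAt_of_segment_subset (hU.segment_subset hu hz))
  exact this

/-- The three-point inequality for a prox-mapping step with two prox-terms. -/
lemma IsDistanceGenerating.three_point_le (h : IsDistanceGenerating U p φ gφ)
    (hU : Convex ℝ U) {c x u' u z : Vec d} {a b : ℝ} (hu : u ∈ U) (hz : z ∈ U)
    (hmin : IsMinOn (fun z => inner ℝ c z + a * prox φ gφ x z + b * prox φ gφ u' z) U u) :
    inner ℝ c (u - z) + a * prox φ gφ x u + b * prox φ gφ u' u
      ≤ a * prox φ gφ x z + b * prox φ gφ u' z - (a + b) * prox φ gφ u z := by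
  have h1 := h.variational hU hu hz hmin
  rw [inner_add_left, inner_add_left, inner_smul_left, inner_smul_left] at h1
  rw [prox_three_point x u z, prox_three_point u' u z]
  have h2 : inner ℝ c (u - z) = - inner ℝ c (z - u) := by
    rw [← inner_neg_right, neg_sub]
  simp only [conj_trivial] at h1
  rw [h2]
  nlinarith [h1]

/-- Expanding both values around the convex combination `w` by the three-point identity, the linear
terms cancel and the remainders are prox-distances from `w`, which are nonnegative. -/
lemma IsDistanceGenerating.prox_convexOn (h : IsDistanceGenerating U p φ gφ)
    (hU : Convex ℝ U) {x : Vec d} : ConvexOn ℝ U (prox φ gφ x) := by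
  refine ⟨hU, fun u hu v hv a b ha hb hab => ?_⟩
  set w := a • u + b • v with hw
  have hwU : w ∈ U := hU hu hv ha hb hab
  have h1 := h.prox_nonneg hU hwU hu
  have h2 := h.prox_nonneg hU hwU hv
  have e : a * inner ℝ (gφ w - gφ x) (u - w) + b * inner ℝ (gφ w - gφ x) (v - w) = 0 := by
    rw [← inner_smul_right, ← inner_smul_right, ← inner_add_right]
    have : a • (u - w) + b • (v - w) = 0 := by
      rw [smul_sub, smul_sub, sub_add_sub_comm, ← add_smul, hab, one_smul, hw, sub_self]
    rw [this, inner_zero_right]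
  rw [prox_three_point x w u, prox_three_point x w v]
  simp only [smul_eq_mul]
  have e' : (a + b) * prox φ gφ x w = prox φ gφ x w := by rw [hab, one_mul]
  linarith [mul_nonneg ha h1, mul_nonneg hb h2]

end Bregman
-- One call of the sliding procedure
lemma sum_Icc_one_eq_sum_range {E : Type*} [AddCommMonoid E] (F : ℕ → E) (n : ℕ) :
    ∑ t ∈ Finset.Icc 1 n, F t = ∑ t ∈ Finset.range n, F (t + 1) := by
  induction n with
  | zero => simp
  | succ n ih => rw [Finset.sum_Icc_succ_top (by omega), ih, Finset.sum_range_succ]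

lemma sum_range_add_two (n : ℕ) :
    ∑ t ∈ Finset.range n, ((t : ℝ) + 2) = n * (n + 3) / 2 := by
  induction n with
  | zero => simp
  | succ n ih => rw [Finset.sum_range_succ, ih]; push_cast; ring

section InnerLoop

variable {d : ℕ} {U : Set (Vec d)} {p : Seminorm ℝ (Vec d)} {φ : Vec d → ℝ}
  {gφ : Vec d → Vec d} {f : Vec d → ℝ} {f' : Vec d → Vec d} {M : ℝ}

/-- One prox-step of the sliding procedure with oracle output `g` at the point `q`. -/
lemma prox_step_le (hp : ∀ x, p x = 0 → x = 0) (hU : Convex ℝ U)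
    (hφ : IsDistanceGenerating U p φ gφ)
    (hsub : ∀ x ∈ U, ∀ y ∈ U, 0 ≤ f x - f y - inner ℝ (f' y) (x - y))
    (hupper : ∀ x ∈ U, ∀ y ∈ U, f x - f y - inner ℝ (f' y) (x - y) ≤ M * p (x - y))
    {η B : ℝ} (hB : 0 < B) {w g x q v z : Vec d} (hq : q ∈ U) (hv : v ∈ U) (hz : z ∈ U)
    (hmin : IsMinOn (fun z => inner ℝ (w + g) z + η * prox φ gφ x z + B * prox φ gφ q z) U v) :
    inner ℝ w (v - z) + f v - f z + η * prox φ gφ x v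
      ≤ η * prox φ gφ x z + B * prox φ gφ q z - (η + B) * prox φ gφ v z
        + inner ℝ (g - f' q) (z - q) + (M ^ 2 + dualNorm p (g - f' q) ^ 2) / B := by
  have h1 := hφ.three_point_le hU hv hz hmin
  have h2 := hsub z hz q hq
  have h3 := hupper v hv q hq
  have h4 := inner_le_dualNorm_mul p hp (g - f' q) (-(v - q))
  have h5 := hφ.half_sq_le_prox hU hq hv
  rw [map_neg_eq_map, inner_neg_right] at h4
  set r := p (v - q)
  set D := dualNorm p (g - f' q)
  have e1 : inner ℝ (w + g) (v - z) = inner ℝ w (v - z) + inner ℝ (g - f' q) (v - q)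
      - inner ℝ (g - f' q) (z - q) + inner ℝ (f' q) (v - q) - inner ℝ (f' q) (z - q) := by
    simp only [inner_add_left, inner_sub_left, inner_sub_right]
    ring
  -- Young's inequality: (M + D) r - B r^2 / 2 ≤ (M + D)^2 / (2B) ≤ (M^2 + D^2) / B.
  have h6 : M * r + D * r ≤ B * (1 / 2 * r ^ 2) + (M ^ 2 + D ^ 2) / B := by
    rw [← sub_le_iff_le_add', le_div_iff₀ hB]
    nlinarith [sq_nonneg (B * r - (M + D)), sq_nonneg (M - D)]
  have h7 := mul_le_mul_of_nonneg_left h5 hB.le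
  rw [e1] at h1
  linarith

lemma IsCS.mem_le {lam β : ℕ → ℝ} {T : ℕ} {η : ℝ} {H : ℕ → Vec d → Vec d}
    {w xin xout xhat : Vec d} {u : ℕ → Vec d}
    (h : IsCS U φ gφ lam β T η H w xin u xout xhat) (hxin : xin ∈ U) :
    ∀ t ≤ T, u t ∈ U := by
  intro t ht
  cases t with
  | zero => rw [h.init]; exact hxin
  | succ t => exact h.mem t ht

/-- Shifting the index turns the weights into t + 2 on `range T` and gives a `centerMass`, to which
Jensen's inequality applies directly. -/
lemma IsCS.xhat_eq {lam β : ℕ → ℝ} {T : ℕ} {η : ℝ} {H : ℕ → Vec d → Vec d}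
    {w xin xout xhat : Vec d} {u : ℕ → Vec d}
    (h : IsCS U φ gφ lam β T η H w xin u xout xhat) (hlam : ∀ t, 1 ≤ t → lam t = (t : ℝ) + 1) :
    xhat = (Finset.range T).centerMass (fun t => (t : ℝ) + 2) (fun t => u (t + 1)) := by
  rw [h.hat, sum_Icc_one_eq_sum_range, sum_Icc_one_eq_sum_range, Finset.centerMass]
  have e : ∀ t : ℕ, lam (t + 1) = (t : ℝ) + 2 := fun t => by
    rw [hlam _ (by omega)]; push_cast; ring
  simp only [e]

lemma sum_range_add_two_pos {T : ℕ} (hT : 1 ≤ T) :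
    0 < ∑ t ∈ Finset.range T, ((t : ℝ) + 2) := by
  rw [sum_range_add_two]
  have : (0 : ℝ) < T := by exact_mod_cast hT
  positivity

lemma IsCS.xhat_mem {lam β : ℕ → ℝ} {T : ℕ} {η : ℝ} {H : ℕ → Vec d → Vec d}
    {w xin xout xhat : Vec d} {u : ℕ → Vec d}
    (h : IsCS U φ gφ lam β T η H w xin u xout xhat) (hU : Convex ℝ U) (hT : 1 ≤ T)
    (hlam : ∀ t, 1 ≤ t → lam t = (t : ℝ) + 1) : xhat ∈ U := by
  rw [h.xhat_eq hlam]
  exact hU.centerMass_mem (fun t _ => by positivity) (sum_range_add_two_pos hT)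
    fun t ht => h.mem t (Finset.mem_range.1 ht)

/-- The error bound of one call of the stochastic sliding procedure. -/
lemma IsCS.le {lam β : ℕ → ℝ} {T : ℕ} {η : ℝ} {H : ℕ → Vec d → Vec d}
    {w xin xout xhat : Vec d} {u : ℕ → Vec d}
    (h : IsCS U φ gφ lam β T η H w xin u xout xhat)
    (hp : ∀ x, p x = 0 → x = 0) (hU : Convex ℝ U)
    (hφ : IsDistanceGenerating U p φ gφ) (hf : ConvexOn ℝ U f)
    (hsub : ∀ x ∈ U, ∀ y ∈ U, 0 ≤ f x - f y - inner ℝ (f' y) (x - y))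
    (hupper : ∀ x ∈ U, ∀ y ∈ U, f x - f y - inner ℝ (f' y) (x - y) ≤ M * p (x - y))
    (hlam : ∀ t, 1 ≤ t → lam t = (t : ℝ) + 1) (hβ : ∀ t, 1 ≤ t → β t = (t : ℝ) / 2)
    (hη : 0 < η) (hT : 1 ≤ T) (hxin : xin ∈ U) {z : Vec d} (hz : z ∈ U) {S : ℝ}
    (hS : S = (T : ℝ) * (T + 3) / 2) :
    S * (inner ℝ w (xhat - z) + f xhat - f z + η / 2 * p (xhat - xin) ^ 2)
      ≤ η * (S + 1) * (prox φ gφ xin z - prox φ gφ xout z)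
        + ∑ t ∈ Finset.range T, ((t : ℝ) + 2) * inner ℝ (H t (u t) - f' (u t)) (z - u t)
        + 4 / η * ∑ t ∈ Finset.range T, (M ^ 2 + dualNorm p (H t (u t) - f' (u t)) ^ 2) := by
  have hmem := h.mem_le hxin
  -- The prox-term at `xin` stays inside the function given to Jensen: at `xhat` it produces the
  -- term η/2 · p(xhat - xin)^2 needed by the outer loop.
  let g : Vec d → ℝ := fun y => inner ℝ w y + f y + η * prox φ gφ xin y
  have hg : ConvexOn ℝ U g :=
    (((innerSL ℝ w).toLinearMap.convexOn hU).add hf).add ((hφ.prox_convexOn hU).smul hη.le)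
  have hSsum : ∑ t ∈ Finset.range T, ((t : ℝ) + 2) = S := by rw [sum_range_add_two, hS]
  have hSpos : 0 < S := hSsum ▸ sum_range_add_two_pos hT
  have hjensen : S * g xhat ≤ ∑ t ∈ Finset.range T, ((t : ℝ) + 2) * g (u (t + 1)) := by
    have := hg.map_centerMass_le (t := Finset.range T) (w := fun t => (t : ℝ) + 2)
      (p := fun t => u (t + 1)) (fun t _ => by positivity) (sum_range_add_two_pos hT)
      fun t ht => h.mem t (Finset.mem_range.1 ht)
    rw [← h.xhat_eq hlam, Finset.centerMass, hSsum, smul_eq_mul, ← div_eq_inv_mul,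
      le_div_iff₀ hSpos] at this
    simpa [mul_comm] using this
  -- After multiplication by t + 2 the prox coefficients are η(t+1)(t+2)/2 at `u t` and
  -- η(t+2)(t+3)/2 at `u (t + 1)`, so consecutive steps telescope.
  have hstep : ∀ t < T, ((t : ℝ) + 2) * (g (u (t + 1)) - g z)
      ≤ η * ((t + 1) * (t + 2) / 2) * prox φ gφ (u t) z
        - η * ((t + 2) * (t + 3) / 2) * prox φ gφ (u (t + 1)) z
        + ((t : ℝ) + 2) * inner ℝ (H t (u t) - f' (u t)) (z - u t)
        + 4 / η * (M ^ 2 + dualNorm p (H t (u t) - f' (u t)) ^ 2) := by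
    intro t ht
    have hb : β (t + 1) = ((t : ℝ) + 1) / 2 := by rw [hβ _ (by omega)]; push_cast; ring
    have hB : 0 < η * β (t + 1) := by rw [hb]; positivity
    have h1 := prox_step_le hp hU hφ hsub hupper hB (hmem t ht.le) (h.mem t ht) hz (h.step t ht)
    set D := dualNorm p (H t (u t) - f' (u t))
    -- Here (t + 2)/β_{t+1} = 2(t + 2)/(t + 1) ≤ 4.
    have h2 : ((t : ℝ) + 2) * ((M ^ 2 + D ^ 2) / (η * β (t + 1))) ≤ 4 / η * (M ^ 2 + D ^ 2) := by
      rw [hb, div_mul_eq_mul_div, ← mul_div_assoc, div_le_div_iff₀ (by positivity) hη]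
      have : 0 ≤ (M ^ 2 + D ^ 2) * η * t := by positivity
      nlinarith
    have h3 := mul_le_mul_of_nonneg_left h1 (by positivity : (0 : ℝ) ≤ (t : ℝ) + 2)
    have e : g (u (t + 1)) - g z = inner ℝ w (u (t + 1) - z) + f (u (t + 1)) - f z
        + η * prox φ gφ xin (u (t + 1)) - η * prox φ gφ xin z := by
      simp only [g, inner_sub_right]; ring
    rw [e]
    rw [hb] at h3 h2
    linarith
  have hsum : ∀ n ≤ T, ∑ t ∈ Finset.range n, ((t : ℝ) + 2) * (g (u (t + 1)) - g z)
      ≤ η * prox φ gφ xin z - η * (((n : ℝ) + 1) * (n + 2) / 2) * prox φ gφ (u n) z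
        + ∑ t ∈ Finset.range n, ((t : ℝ) + 2) * inner ℝ (H t (u t) - f' (u t)) (z - u t)
        + 4 / η * ∑ t ∈ Finset.range n, (M ^ 2 + dualNorm p (H t (u t) - f' (u t)) ^ 2) := by
    intro n
    induction n with
    | zero => intro _; simp [h.init]
    | succ n ih =>
      intro hn
      have h1 := ih (by omega)
      have h2 := hstep n (by omega)
      rw [Finset.sum_range_succ, Finset.sum_range_succ, Finset.sum_range_succ, mul_add]
      push_cast
      linarith
  have hfin := hsum T le_rfl
  have e1 : ∑ t ∈ Finset.range T, ((t : ℝ) + 2) * (g (u (t + 1)) - g z)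
      = ∑ t ∈ Finset.range T, ((t : ℝ) + 2) * g (u (t + 1)) - S * g z := by
    rw [← hSsum, Finset.sum_mul, ← Finset.sum_sub_distrib]
    exact Finset.sum_congr rfl fun t _ => by ring
  have e2 : ((T : ℝ) + 1) * (T + 2) / 2 = S + 1 := by rw [hS]; ring
  rw [e1, e2, ← h.out] at hfin
  have hquad := hφ.half_sq_le_prox hU hxin (h.xhat_mem hU hT hlam)
  have h5 : S * (inner ℝ w (xhat - z) + f xhat - f z + η / 2 * p (xhat - xin) ^ 2)
      ≤ S * (g xhat - g z) + S * (η * prox φ gφ xin z) := by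
    rw [← mul_add]
    refine mul_le_mul_of_nonneg_left ?_ hSpos.le
    have := mul_le_mul_of_nonneg_left hquad hη.le
    simp only [g, inner_sub_right]
    linarith
  linarith

end InnerLoop

/-! ### The primal-dual outer loop, pathwise -/

section OuterLoop

variable {m d : ℕ} {Γ : SimpleGraph (Fin m)} [DecidableRel Γ.Adj]
  {X : Fin m → Set (Vec d)} {φ : Fin m → Vec d → ℝ} {gφ : Fin m → Vec d → Vec d}
  {α η τ : ℕ → ℝ} {T : ℕ → ℕ} {lam β : ℕ → ℝ} {N : ℕ}
  {H : Fin m → ℕ → ℕ → Vec d → Vec d} {x0 y0 : Stack m d}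
  {x xhat y : ℕ → Stack m d} {u : Fin m → ℕ → ℕ → Vec d}

lemma IsRun.x_mem (h : IsRun Γ X φ gφ α η τ T lam β N H x0 y0 x xhat y u)
    (hT : ∀ k < N, 1 ≤ T (k + 1)) (hx0 : ∀ i, x0 i ∈ X i) : ∀ k ≤ N, ∀ i, x k i ∈ X i := by
  intro k hk i
  cases k with
  | zero => rw [h.init_x]; exact hx0 i
  | succ k =>
    have hcs := h.primal k hk i
    have := hT k hk
    rw [hcs.out]
    obtain ⟨t, ht⟩ : ∃ t, T (k + 1) = t + 1 := ⟨T (k + 1) - 1, by omega⟩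
    rw [ht]
    exact hcs.mem t (by omega)

lemma IsRun.u_mem (h : IsRun Γ X φ gφ α η τ T lam β N H x0 y0 x xhat y u)
    (hT : ∀ k < N, 1 ≤ T (k + 1)) (hx0 : ∀ i, x0 i ∈ X i) {k t : ℕ} (hk : k < N)
    (ht : t ≤ T (k + 1)) (i : Fin m) : u i (k + 1) t ∈ X i :=
  (h.primal k hk i).mem_le (h.x_mem hT hx0 k hk.le i) t ht

variable {p : Fin m → Seminorm ℝ (Vec d)} {f : Fin m → Vec d → ℝ}
  {f' : Fin m → Vec d → Vec d} {M : ℝ}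

/-- The accumulated stochastic error of outer iteration `k + 1`. -/
noncomputable def noise (p : Fin m → Seminorm ℝ (Vec d)) (f' : Fin m → Vec d → Vec d) (M : ℝ)
    (H : Fin m → ℕ → ℕ → Vec d → Vec d) (u : Fin m → ℕ → ℕ → Vec d) (xs : Stack m d) (T : ℕ)
    (η : ℝ) (k : ℕ) : ℝ :=
  ∑ i, (∑ t ∈ Finset.range T, ((t : ℝ) + 2)
      * inner ℝ (H i (k + 1) t (u i (k + 1) t) - f' i (u i (k + 1) t)) (xs i - u i (k + 1) t)
    + 4 / η * ∑ t ∈ Finset.range T,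
      (M ^ 2 + dualNorm (p i) (H i (k + 1) t (u i (k + 1) t) - f' i (u i (k + 1) t)) ^ 2))

/-- The aggregate Lagrangian gap of the outer iterates, for an arbitrary dual vector `Y`. -/
lemma IsRun.sum_gap_le (h : IsRun Γ X φ gφ α η τ T lam β N H x0 y0 x xhat y u)
    (hp : ∀ i x, p i x = 0 → x = 0) (hX : ∀ i, Convex ℝ (X i))
    (hφ : ∀ i, IsDistanceGenerating (X i) (p i) (φ i) (gφ i))
    (hf : ∀ i, ConvexOn ℝ (X i) (f i))
    (hsub : ∀ i, ∀ x ∈ X i, ∀ y ∈ X i, 0 ≤ f i x - f i y - inner ℝ (f' i y) (x - y))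
    (hupper : ∀ i, ∀ x ∈ X i, ∀ y ∈ X i,
      f i x - f i y - inner ℝ (f' i y) (x - y) ≤ M * p i (x - y))
    (hlam : ∀ t, 1 ≤ t → lam t = (t : ℝ) + 1) (hβ : ∀ t, 1 ≤ t → β t = (t : ℝ) / 2)
    {L : ℝ} (hLdef : L = lapNorm Γ p) (hL : 0 < L) (hα : ∀ k < N, α (k + 1) = 1)
    (hη : ∀ k < N, η (k + 1) = 2 * L) (hτ : ∀ k < N, τ (k + 1) = L)
    {T0 : ℕ} (hT0 : 1 ≤ T0) (hT : ∀ k < N, T (k + 1) = T0) (hx0 : ∀ i, x0 i ∈ X i)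
    {xs : Stack m d} (hxs : ∀ i, xs i ∈ X i) (hfeas : lap Γ xs = 0) {S : ℝ}
    (hS : S = (T0 : ℝ) * (T0 + 3) / 2) (Y : Stack m d) :
    ∑ k ∈ Finset.range N, (obj f (xhat (k + 1)) - obj f xs + inner ℝ (lap Γ (xhat (k + 1))) Y)
      ≤ L / 2 * ‖Y - y0‖ ^ 2 + 2 * L * (1 + 1 / S) * ∑ i, prox (φ i) (gφ i) (x0 i) (xs i)
        + 1 / S * ∑ k ∈ Finset.range N, noise p f' M H u xs T0 (2 * L) k := by
  have hSpos : 0 < S := by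
    have := sum_range_add_two_pos hT0
    rwa [sum_range_add_two, ← hS] at this
  have hT1 : ∀ k < N, 1 ≤ T (k + 1) := fun k hk => by rw [hT k hk]; exact hT0
  have hxm := h.x_mem hT1 hx0
  -- Natural subtraction makes `a 0` the image of `xhat 0 - x 0 = 0`, so no cross term is present at
  -- the start.
  set a : ℕ → Stack m d := fun k => lap Γ (xhat k - x (k - 1)) with ha
  set V : ℕ → ℝ := fun k => ∑ i, prox (φ i) (gφ i) (x k i) (xs i) with hV
  set Φ : ℕ → ℝ := fun k => L / 2 * ‖Y - y k‖ ^ 2 + 2 * L * (1 + 1 / S) * V k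
    - inner ℝ (a k) (Y - y k) + 1 / (2 * L) * ‖a k‖ ^ 2 with hΦ
  have hstep : ∀ k < N,
      obj f (xhat (k + 1)) - obj f xs + inner ℝ (lap Γ (xhat (k + 1))) Y
        ≤ Φ k - Φ (k + 1) + 1 / S * noise p f' M H u xs T0 (2 * L) k := by
    intro k hk
    have hcs : ∀ i, inner ℝ (lap Γ (y (k + 1)) i) (xhat (k + 1) i - xs i)
        + f i (xhat (k + 1) i) - f i (xs i) + L * p i (xhat (k + 1) i - x k i) ^ 2
        ≤ 2 * L * (1 + 1 / S) * (prox (φ i) (gφ i) (x k i) (xs i)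
          - prox (φ i) (gφ i) (x (k + 1) i) (xs i))
        + 1 / S * (∑ t ∈ Finset.range T0, ((t : ℝ) + 2)
          * inner ℝ (H i (k + 1) t (u i (k + 1) t) - f' i (u i (k + 1) t)) (xs i - u i (k + 1) t)
          + 4 / (2 * L) * ∑ t ∈ Finset.range T0, (M ^ 2
            + dualNorm (p i) (H i (k + 1) t (u i (k + 1) t) - f' i (u i (k + 1) t)) ^ 2)) := by
      intro i
      have hc := h.primal k hk i
      rw [hT k hk, hη k hk] at hc
      have := hc.le (hp i) (hX i) (hφ i) (hf i) (hsub i) (hupper i) hlam hβ (by positivity) hT0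
        (hxm k hk.le i) (hxs i) hS
      have e : 2 * L * (1 + 1 / S) = 2 * L * (S + 1) / S := by field_simp
      rw [e, one_div_mul_eq_div, div_mul_eq_mul_div, ← add_div, le_div_iff₀ hSpos]
      linarith
    have hsum := Finset.sum_le_sum fun i (_ : i ∈ Finset.univ) => hcs i
    simp only [Finset.sum_add_distrib, Finset.sum_sub_distrib, ← Finset.mul_sum] at hsum
    have e1 : ∑ i, inner ℝ (lap Γ (y (k + 1)) i) (xhat (k + 1) i - xs i)
        = inner ℝ (lap Γ (xhat (k + 1))) (y (k + 1)) := by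
      have : ∑ i, inner ℝ (lap Γ (y (k + 1)) i) (xhat (k + 1) i - xs i)
          = inner ℝ (lap Γ (y (k + 1))) (xhat (k + 1) - xs) := by
        rw [PiLp.inner_apply]; rfl
      rw [this, inner_lap_left, lap_sub, hfeas, sub_zero, real_inner_comm]
    have e2 : ∑ i, p i (xhat (k + 1) i - x k i) ^ 2 = stackNorm p (xhat (k + 1) - x k) ^ 2 := by
      rw [stackNorm_sq]; rfl
    have hdual := h.dual k hk
    rw [hτ k hk] at hdual
    have e3 : L • (y (k + 1) - y k) = a k + lap Γ (x k) := by
      rw [hdual, add_sub_cancel_left, smul_smul, mul_one_div_cancel hL.ne', one_smul, predict,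
        hα k hk, one_smul, lap_add]
    -- The extrapolation was chosen for this: 𝐋 xhat is the scaled dual increment plus a difference
    -- of consecutive `a`, so the cross terms telescope.
    have e4 : lap Γ (xhat (k + 1)) = a (k + 1) - a k + L • (y (k + 1) - y k) := by
      rw [e3]
      simp only [ha, add_tsub_cancel_right, lap_sub]
      abel
    have ha1 : ‖a (k + 1)‖ ^ 2 ≤ L ^ 2 * stackNorm p (xhat (k + 1) - x k) ^ 2 := by
      rw [← mul_pow, hLdef]
      exact pow_le_pow_left₀ (norm_nonneg _) (norm_lap_le Γ hp _) 2
    -- The term η/2 · p^2 with η = 2L pays for the square that enters the potential at `k + 1`.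
    have ha2 : 1 / (2 * L) * ‖a (k + 1)‖ ^ 2
        ≤ L * stackNorm p (xhat (k + 1) - x k) ^ 2 := by
      rw [one_div_mul_eq_div, div_le_iff₀ (by positivity)]
      have : 0 ≤ L ^ 2 * stackNorm p (xhat (k + 1) - x k) ^ 2 := by positivity
      linarith
    have e5 : inner ℝ (lap Γ (xhat (k + 1))) (Y - y (k + 1))
        = inner ℝ (a (k + 1)) (Y - y (k + 1)) - inner ℝ (a k) (Y - y k)
          + inner ℝ (a k) (y (k + 1) - y k)
          + L * inner ℝ (y (k + 1) - y k) (Y - y (k + 1)) := by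
      rw [e4]
      simp only [inner_add_left, inner_sub_left, inner_sub_right, inner_smul_left, conj_trivial]
      ring
    have e6 : ‖Y - y k‖ ^ 2 = ‖y (k + 1) - y k‖ ^ 2
        + 2 * inner ℝ (y (k + 1) - y k) (Y - y (k + 1)) + ‖Y - y (k + 1)‖ ^ 2 := by
      rw [← norm_add_sq_real]
      congr 2
      abel
    -- The first term on the right cancels the loss -L/2 ‖y (k + 1) - y k‖^2 from the polarization
    -- `e6`; the second is the square stored in `Φ k`.
    have h7 : inner ℝ (a k) (y (k + 1) - y k)
        ≤ L / 2 * ‖y (k + 1) - y k‖ ^ 2 + 1 / (2 * L) * ‖a k‖ ^ 2 := by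
      refine (real_inner_le_norm _ _).trans ?_
      have : 0 ≤ 1 / (2 * L) * (L * ‖y (k + 1) - y k‖ - ‖a k‖) ^ 2 := by positivity
      have e : 1 / (2 * L) * (L * ‖y (k + 1) - y k‖ - ‖a k‖) ^ 2
          = L / 2 * ‖y (k + 1) - y k‖ ^ 2 - ‖a k‖ * ‖y (k + 1) - y k‖
            + 1 / (2 * L) * ‖a k‖ ^ 2 := by
        field_simp
        ring
      linarith
    have e8 : inner ℝ (lap Γ (xhat (k + 1))) Y = inner ℝ (lap Γ (xhat (k + 1))) (y (k + 1))
        + inner ℝ (lap Γ (xhat (k + 1))) (Y - y (k + 1)) := by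
      rw [inner_sub_right]; ring
    have e9 : noise p f' M H u xs T0 (2 * L) k = ∑ i, (∑ t ∈ Finset.range T0, ((t : ℝ) + 2)
          * inner ℝ (H i (k + 1) t (u i (k + 1) t) - f' i (u i (k + 1) t)) (xs i - u i (k + 1) t))
          + 4 / (2 * L) * ∑ i, ∑ t ∈ Finset.range T0, (M ^ 2
            + dualNorm (p i) (H i (k + 1) t (u i (k + 1) t) - f' i (u i (k + 1) t)) ^ 2) := by
      rw [noise, Finset.sum_add_distrib, Finset.mul_sum]
    simp only [Finset.sum_add_distrib] at e9
    rw [e1, e2] at hsum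
    rw [e8, e5, e9]
    simp only [hΦ, hV, obj]
    rw [e6]
    linarith
  have htel : ∀ n ≤ N, ∑ k ∈ Finset.range n,
      (obj f (xhat (k + 1)) - obj f xs + inner ℝ (lap Γ (xhat (k + 1))) Y)
        ≤ Φ 0 - Φ n + 1 / S * ∑ k ∈ Finset.range n, noise p f' M H u xs T0 (2 * L) k := by
    intro n
    induction n with
    | zero => intro _; simp
    | succ n ih =>
      intro hn
      have h1 := ih (by omega)
      have h2 := hstep n (by omega)
      rw [Finset.sum_range_succ, Finset.sum_range_succ, mul_add]
      linarith
  have hΦ0 : Φ 0 = L / 2 * ‖Y - y0‖ ^ 2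
      + 2 * L * (1 + 1 / S) * ∑ i, prox (φ i) (gφ i) (x0 i) (xs i) := by
    simp [hΦ, ha, hV, h.init_x, h.init_y, h.init_hat, lap_zero]
  have hΦN : 0 ≤ Φ N := by
    have hVN : 0 ≤ V N :=
      Finset.sum_nonneg fun i _ => (hφ i).prox_nonneg (hX i) (hxm N le_rfl i) (hxs i)
    have h1 := real_inner_le_norm (a N) (Y - y N)
    have h2 : 0 ≤ 1 / (2 * L) * (L * ‖Y - y N‖ - ‖a N‖) ^ 2 := by positivity
    have e : 1 / (2 * L) * (L * ‖Y - y N‖ - ‖a N‖) ^ 2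
        = L / 2 * ‖Y - y N‖ ^ 2 - ‖a N‖ * ‖Y - y N‖ + 1 / (2 * L) * ‖a N‖ ^ 2 := by
      field_simp
      ring
    have h3 : 0 ≤ 2 * L * (1 + 1 / S) * V N := by positivity
    simp only [hΦ]
    linarith
  have := htel N le_rfl
  rw [hΦ0] at this
  linarith

end OuterLoop
-- Elementary exponential inequalities
section Exponential

/-- For |x| ≤ 1 this compares the second-order bound for exp x with 1 + x^2 ≤ exp (x^2). For x ≥ 1
it follows from x ≤ x^2, and for x ≤ -1 from exp x ≤ 1 ≤ 1 + x + x^2. -/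
lemma exp_le_add_exp_sq (x : ℝ) : Real.exp x ≤ x + Real.exp (x ^ 2) := by
  have h2 := Real.add_one_le_exp (x ^ 2)
  rcases le_total |x| 1 with h | h
  · have h1 := (abs_le.1 (Real.abs_exp_sub_one_sub_id_le h)).2
    linarith
  · rcases le_abs.1 h with hx | hx
    · have : Real.exp x ≤ Real.exp (x ^ 2) := Real.exp_le_exp.2 (by nlinarith)
      linarith
    · have : Real.exp x ≤ 1 := Real.exp_le_one_iff.2 (by linarith)
      nlinarith

/-- A bound for `exp (γ Δ)` that is linear in `Δ` and in `exp D`, if `Δ^2 ≤ v D`. -/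
lemma exists_exp_mul_le (γ : ℝ) {v : ℝ} (hv : 0 ≤ v) :
    ∃ c b : ℝ, 0 ≤ b ∧ b ≤ 1 ∧ ∀ Δ D : ℝ, 0 ≤ D → Δ ^ 2 ≤ v * D →
      Real.exp (γ * Δ)
        ≤ c * Δ + Real.exp (γ ^ 2 * v) * (1 - b + b * Real.exp (D - 1)) := by
  have hconv : ∀ b y : ℝ, 0 ≤ b → b ≤ 1 → Real.exp (b * y) ≤ 1 - b + b * Real.exp y := by
    intro b y h0 h1
    have := convexOn_exp.2 (Set.mem_univ 0) (Set.mem_univ y) (sub_nonneg.2 h1) h0 (by ring)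
    simpa using this
  set a := γ ^ 2 * v with ha
  have ha0 : 0 ≤ a := by positivity
  rcases le_total a 1 with h1 | h1
  · refine ⟨γ, a, ha0, h1, fun Δ D hD hΔ => ?_⟩
    have h2 : (γ * Δ) ^ 2 ≤ a + a * (D - 1) := by
      have := mul_le_mul_of_nonneg_left hΔ (sq_nonneg γ)
      rw [mul_pow, ha]
      linarith
    calc Real.exp (γ * Δ) ≤ γ * Δ + Real.exp ((γ * Δ) ^ 2) := exp_le_add_exp_sq _
      _ ≤ γ * Δ + Real.exp (a + a * (D - 1)) := by gcongr
      _ ≤ γ * Δ + Real.exp a * (1 - a + a * Real.exp (D - 1)) := by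
        rw [Real.exp_add]
        gcongr
        exact hconv a _ ha0 h1
  -- For γ^2 v ≥ 1 no centring is needed: γΔ ≤ (a + D)/2 ≤ a + (D - 1)/2.
  · refine ⟨0, 1 / 2, by norm_num, by norm_num, fun Δ D hD hΔ => ?_⟩
    have h2 : γ * Δ ≤ a + 1 / 2 * (D - 1) := by
      have h3 : (γ * Δ) ^ 2 ≤ a * D := by
        have := mul_le_mul_of_nonneg_left hΔ (sq_nonneg γ)
        rw [mul_pow, ha]
        linarith
      have h4 : γ * Δ ≤ (a + D) / 2 :=
        le_of_sq_le_sq (by nlinarith [sq_nonneg (a - D)]) (by positivity)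
      linarith
    calc Real.exp (γ * Δ) ≤ Real.exp (a + 1 / 2 * (D - 1)) := Real.exp_le_exp.2 h2
      _ ≤ 0 * Δ + Real.exp a * (1 - 1 / 2 + 1 / 2 * Real.exp (D - 1)) := by
        rw [Real.exp_add, zero_mul, zero_add]
        gcongr
        exact hconv (1 / 2) _ (by norm_num) (by norm_num)

end Exponential

/-! ### Sub-Gaussian moments, weighted by the past -/

section Conditional

variable {Ω : Type*} [mΩ : MeasurableSpace Ω] {P : Measure Ω}

/-- Sub-Gaussian estimate, conditional on `Z`, for a sum of centred errors with light tails that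
need not be independent of each other. -/
lemma lintegral_mul_exp_sum_le {ι : Type*} [Fintype ι] [Nonempty ι] {Z : Ω → ℝ}
    (hZ : Measurable Z) (hZ0 : ∀ s, 0 ≤ Z s) {Δ D : ι → Ω → ℝ} (hΔ : ∀ i, Measurable (Δ i))
    (hD : ∀ i, Measurable (D i)) (hD0 : ∀ i s, 0 ≤ D i s) {v : ι → ℝ} (hv : ∀ i, 0 ≤ v i)
    (hΔD : ∀ i s, Δ i s ^ 2 ≤ v i * D i s)
    (hcentred : ∀ i, Integrable (fun s => Z s * Δ i s) P → ∫ s, Z s * Δ i s ∂P = 0)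
    (htail : ∀ i, ∫⁻ s, ENNReal.ofReal (Z s) * ENNReal.ofReal (Real.exp (D i s)) ∂P
      ≤ ENNReal.ofReal (Real.exp 1) * ∫⁻ s, ENNReal.ofReal (Z s) ∂P) (γ : ℝ) :
    ∫⁻ s, ENNReal.ofReal (Z s * Real.exp (γ * ∑ i, Δ i s)) ∂P
      ≤ ENNReal.ofReal (Real.exp (γ ^ 2 * (Fintype.card ι * ∑ i, v i)))
        * ∫⁻ s, ENNReal.ofReal (Z s) ∂P := by
  by_cases htop : ∫⁻ s, ENNReal.ofReal (Z s) ∂P = ⊤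
  -- If the weight has infinite integral the bound is trivial; otherwise everything below is
  -- integrable, and Bochner integrals can be used to cancel the centred terms.
  · rw [htop, ENNReal.mul_top (by simp [Real.exp_pos])]
    exact le_top
  have hZint : Integrable Z P :=
    (lintegral_ofReal_ne_top_iff_integrable hZ.aestronglyMeasurable
      (Filter.Eventually.of_forall hZ0)).1 htop
  have hZeq := ofReal_integral_eq_lintegral_ofReal hZint (Filter.Eventually.of_forall hZ0)
  have hE0 : ∀ i s, 0 ≤ Z s * Real.exp (D i s) := fun i s =>
    mul_nonneg (hZ0 s) (Real.exp_pos _).le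
  have htail' : ∀ i, ∫⁻ s, ENNReal.ofReal (Z s * Real.exp (D i s)) ∂P
      ≤ ENNReal.ofReal (Real.exp 1 * ∫ s, Z s ∂P) := by
    intro i
    rw [ENNReal.ofReal_mul (Real.exp_pos 1).le, hZeq]
    refine le_trans (le_of_eq ?_) (htail i)
    exact lintegral_congr fun s => ENNReal.ofReal_mul (hZ0 s)
  have hEint : ∀ i, Integrable (fun s => Z s * Real.exp (D i s)) P := fun i =>
    (lintegral_ofReal_ne_top_iff_integrable
      (hZ.mul (hD i).exp).aestronglyMeasurable (Filter.Eventually.of_forall (hE0 i))).1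
      ((htail' i).trans_lt ENNReal.ofReal_lt_top).ne
  have hEle : ∀ i, ∫ s, Z s * Real.exp (D i s) ∂P ≤ Real.exp 1 * ∫ s, Z s ∂P := by
    intro i
    have := htail' i
    rw [← ofReal_integral_eq_lintegral_ofReal (hEint i)
      (Filter.Eventually.of_forall (hE0 i))] at this
    exact (ENNReal.ofReal_le_ofReal_iff
      (mul_nonneg (Real.exp_pos 1).le (integral_nonneg hZ0))).1 this
  have hΔint : ∀ i, Integrable (fun s => Z s * Δ i s) P := by
    intro i
    refine (hZint.add ((hEint i).const_mul (v i))).mono'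
      (hZ.mul (hΔ i)).aestronglyMeasurable (Filter.Eventually.of_forall fun s => ?_)
    have h1 : |Δ i s| ≤ 1 + v i * Real.exp (D i s) := by
      have h2 := hΔD i s
      have h3 : D i s ≤ Real.exp (D i s) := by linarith [Real.add_one_le_exp (D i s)]
      have h4 := mul_le_mul_of_nonneg_left h3 (hv i)
      rw [← sq_abs] at h2
      nlinarith [sq_nonneg (|Δ i s| - 1), abs_nonneg (Δ i s)]
    rw [Real.norm_eq_abs, abs_mul, abs_of_nonneg (hZ0 s)]
    have := mul_le_mul_of_nonneg_left h1 (hZ0 s)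
    simp only [Pi.add_apply]
    linarith
  set n : ℝ := (Fintype.card ι : ℝ) with hndef
  have hn : 0 < n := by simp [n, Fintype.card_pos]
  have hvsum : 0 ≤ n * ∑ i, v i := mul_nonneg hn.le (Finset.sum_nonneg fun i _ => hv i)
  obtain ⟨c, b, hb0, hb1, hexp⟩ := exists_exp_mul_le γ hvsum
  set A := Real.exp (γ ^ 2 * (n * ∑ i, v i))
  have hA : 0 < A := Real.exp_pos _
  let R : Ω → ℝ := fun s => c * ∑ i, Z s * Δ i s + (A * (1 - b) * Z s
    + A * b * Real.exp (-1) * n⁻¹ * ∑ i, Z s * Real.exp (D i s))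
  have hpt : ∀ s, Z s * Real.exp (γ * ∑ i, Δ i s) ≤ R s := by
    intro s
    have hDs : 0 ≤ n⁻¹ * ∑ i, D i s :=
      mul_nonneg (inv_pos.2 hn).le (Finset.sum_nonneg fun i _ => hD0 i s)
    -- Cauchy–Schwarz replaces independence between agents. The factor n is split so that the tail
    -- variable becomes the mean of the `D i`, to which Jensen applies below.
    have hcs : (∑ i, Δ i s) ^ 2 ≤ (n * ∑ i, v i) * (n⁻¹ * ∑ i, D i s) := by
      have := Finset.sum_sq_le_sum_mul_sum_of_sq_le_mul Finset.univ
        (r := fun i => Δ i s) (fun i _ => hv i) (fun i _ => hD0 i s) (fun i _ => hΔD i s)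
      calc _ ≤ _ := this
        _ = _ := by field_simp
    have h1 := hexp _ _ hDs hcs
    have hj : Real.exp (n⁻¹ * ∑ i, D i s) ≤ n⁻¹ * ∑ i, Real.exp (D i s) := by
      have := convexOn_exp.map_sum_le (t := Finset.univ) (w := fun _ : ι => n⁻¹)
        (p := fun i => D i s) (fun _ _ => (inv_pos.2 hn).le)
        (by simp [n]) (fun _ _ => Set.mem_univ _)
      simpa [← Finset.mul_sum] using this
    have h2 : Real.exp (n⁻¹ * ∑ i, D i s - 1)
        ≤ Real.exp (-1) * (n⁻¹ * ∑ i, Real.exp (D i s)) := by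
      rw [sub_eq_neg_add, Real.exp_add]
      gcongr
    have h3 : Real.exp (γ * ∑ i, Δ i s) ≤ c * ∑ i, Δ i s
        + A * (1 - b + b * (Real.exp (-1) * (n⁻¹ * ∑ i, Real.exp (D i s)))) := by
      refine h1.trans ?_
      gcongr
    refine (mul_le_mul_of_nonneg_left h3 (hZ0 s)).trans (le_of_eq ?_)
    simp only [R, ← Finset.mul_sum]
    ring
  have hI1 : Integrable (fun s => c * ∑ i, Z s * Δ i s) P :=
    (integrable_finsetSum _ fun i _ => hΔint i).const_mul c
  have hI2 : Integrable (fun s => A * (1 - b) * Z s) P := hZint.const_mul _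
  have hI3 : Integrable (fun s => A * b * Real.exp (-1) * n⁻¹
      * ∑ i, Z s * Real.exp (D i s)) P :=
    (integrable_finsetSum _ fun i _ => hEint i).const_mul _
  have hI23 : Integrable (fun s => A * (1 - b) * Z s + A * b * Real.exp (-1) * n⁻¹
      * ∑ i, Z s * Real.exp (D i s)) P := hI2.add hI3
  have hR : Integrable R P := hI1.add hI23
  have hR0 : ∀ s, 0 ≤ R s := fun s =>
    (mul_nonneg (hZ0 s) (Real.exp_pos _).le).trans (hpt s)
  have hRint : ∫ s, R s ∂P ≤ A * ∫ s, Z s ∂P := by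
    have e : ∫ s, R s ∂P = A * (1 - b) * ∫ s, Z s ∂P
        + A * b * Real.exp (-1) * n⁻¹ * ∑ i, ∫ s, Z s * Real.exp (D i s) ∂P := by
      change ∫ s, (c * ∑ i, Z s * Δ i s + (A * (1 - b) * Z s
        + A * b * Real.exp (-1) * n⁻¹ * ∑ i, Z s * Real.exp (D i s))) ∂P = _
      rw [integral_add hI1 hI23, integral_add hI2 hI3, integral_const_mul,
        integral_const_mul, integral_const_mul, integral_finsetSum _ fun i _ => hΔint i,
        integral_finsetSum _ fun i _ => hEint i,
        Finset.sum_eq_zero fun i _ => hcentred i (hΔint i)]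
      ring
    have h1 : ∑ i, ∫ s, Z s * Real.exp (D i s) ∂P ≤ n * (Real.exp 1 * ∫ s, Z s ∂P) := by
      refine (Finset.sum_le_sum fun i _ => hEle i).trans (le_of_eq ?_)
      simp [n]
    rw [e]
    calc _ ≤ A * (1 - b) * ∫ s, Z s ∂P
          + A * b * Real.exp (-1) * n⁻¹ * (n * (Real.exp 1 * ∫ s, Z s ∂P)) := by
          gcongr
      _ = A * (1 - b) * ∫ s, Z s ∂P
          + A * b * (Real.exp (-1) * Real.exp 1) * (n⁻¹ * n) * ∫ s, Z s ∂P := by ring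
      _ = A * ∫ s, Z s ∂P := by
          rw [← Real.exp_add, inv_mul_cancel₀ hn.ne']
          norm_num
          ring
  calc _ ≤ ∫⁻ s, ENNReal.ofReal (R s) ∂P :=
        lintegral_mono fun s => ENNReal.ofReal_le_ofReal (hpt s)
    _ = ENNReal.ofReal (∫ s, R s ∂P) :=
        (ofReal_integral_eq_lintegral_ofReal hR (Filter.Eventually.of_forall hR0)).symm
    _ ≤ ENNReal.ofReal (A * ∫ s, Z s ∂P) := ENNReal.ofReal_le_ofReal hRint
    _ = _ := by rw [ENNReal.ofReal_mul hA.le, hZeq]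

end Conditional

/-! ### Integrating out the fresh oracle input -/

section FreshRandomness

variable {Ω A B : Type*} {𝓕 : MeasurableSpace Ω} [mΩ : MeasurableSpace Ω] {P : Measure Ω}
  [IsProbabilityMeasure P] [MeasurableSpace A] [MeasurableSpace B]

/-- Integrating out fresh randomness, for nonnegative functions. -/
lemma lintegral_mul_le_of_indep (h𝓕 : 𝓕 ≤ mΩ) {W : Ω → B} (hW : Measurable W)
    (hind : Indep (MeasurableSpace.comap W inferInstance) 𝓕 P) {Y : Ω → A}
    (hY : Measurable[𝓕] Y) {Z : Ω → ENNReal} (hZ : Measurable[𝓕] Z) {h : A → B → ENNReal}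
    (hh : Measurable (Function.uncurry h)) {C : ENNReal}
    (hC : ∀ s, ∫⁻ r, h (Y s) (W r) ∂P ≤ C) :
    ∫⁻ s, Z s * h (Y s) (W s) ∂P ≤ C * ∫⁻ s, Z s ∂P := by
  have hsec : ∀ s, Measurable (h (Y s)) := fun s =>
    hh.comp (measurable_const.prodMk measurable_id)
  have hZY : Measurable[𝓕] fun s => (Z s, Y s) := hZ.prodMk hY
  have hZY' : Measurable fun s => (Z s, Y s) := hZY.mono h𝓕 le_rfl
  -- Weight and query point are both determined by the past, so jointly with the fresh input they
  -- have a product law. Tonelli then does the work of a conditional expectation.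
  have hI : IndepFun (fun s => (Z s, Y s)) W P := by
    rw [IndepFun_iff_Indep]
    exact (indep_of_indep_of_le_right hind hZY.comap_le).symm
  have hmap := (indepFun_iff_map_prod_eq_prod_map_map hZY'.aemeasurable hW.aemeasurable).1 hI
  have := Measure.isProbabilityMeasure_map (μ := P) hW.aemeasurable
  have hmeas : Measurable fun q : (ENNReal × A) × B => q.1.1 * h q.1.2 q.2 :=
    (measurable_fst.comp measurable_fst).mul
      (hh.comp ((measurable_snd.comp measurable_fst).prodMk measurable_snd))
  calc ∫⁻ s, Z s * h (Y s) (W s) ∂P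
      = ∫⁻ q, q.1.1 * h q.1.2 q.2 ∂(P.map fun s => ((Z s, Y s), W s)) :=
        (lintegral_map hmeas (hZY'.prodMk hW)).symm
    _ = ∫⁻ a, ∫⁻ b, a.1 * h a.2 b ∂(P.map W) ∂(P.map fun s => (Z s, Y s)) := by
        rw [hmap, lintegral_prod _ hmeas.aemeasurable]
    _ = ∫⁻ s, ∫⁻ b, Z s * h (Y s) b ∂(P.map W) ∂P :=
        lintegral_map hmeas.lintegral_prod_right' hZY'
    _ = ∫⁻ s, ∫⁻ r, Z s * h (Y s) (W r) ∂P ∂P := by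
        refine lintegral_congr fun s => lintegral_map ?_ hW
        exact measurable_const.mul (hsec s)
    _ ≤ ∫⁻ s, C * Z s ∂P := by
        refine lintegral_mono fun s => ?_
        have hhW : Measurable fun r => h (Y s) (W r) := (hsec s).comp hW
        rw [lintegral_const_mul _ hhW, mul_comm C]
        gcongr
        exact hC s
    _ = C * ∫⁻ s, Z s ∂P := lintegral_const_mul _ (hZ.mono h𝓕 le_rfl)

/-- Integrating out fresh randomness: centred errors stay centred given the past. -/
lemma integral_mul_eq_zero_of_indep (h𝓕 : 𝓕 ≤ mΩ) {W : Ω → B} (hW : Measurable W)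
    (hind : Indep (MeasurableSpace.comap W inferInstance) 𝓕 P) {Y : Ω → A}
    (hY : Measurable[𝓕] Y) {Z : Ω → ℝ} (hZ : Measurable[𝓕] Z) {h : A → B → ℝ}
    (hh : Measurable (Function.uncurry h)) (h0 : ∀ s, ∫ r, h (Y s) (W r) ∂P = 0)
    (hint : Integrable (fun s => Z s * h (Y s) (W s)) P) :
    ∫ s, Z s * h (Y s) (W s) ∂P = 0 := by
  have hsec : ∀ s, Measurable (h (Y s)) := fun s =>
    hh.comp (measurable_const.prodMk measurable_id)
  have hZY : Measurable[𝓕] fun s => (Z s, Y s) := hZ.prodMk hY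
  have hZY' : Measurable fun s => (Z s, Y s) := hZY.mono h𝓕 le_rfl
  have hI : IndepFun (fun s => (Z s, Y s)) W P := by
    rw [IndepFun_iff_Indep]
    exact (indep_of_indep_of_le_right hind hZY.comap_le).symm
  have hmap := (indepFun_iff_map_prod_eq_prod_map_map hZY'.aemeasurable hW.aemeasurable).1 hI
  have := Measure.isProbabilityMeasure_map (μ := P) hW.aemeasurable
  have := Measure.isProbabilityMeasure_map (μ := P) hZY'.aemeasurable
  have hmeas : Measurable fun q : (ℝ × A) × B => q.1.1 * h q.1.2 q.2 :=
    (measurable_fst.comp measurable_fst).mul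
      (hh.comp ((measurable_snd.comp measurable_fst).prodMk measurable_snd))
  have hint' : Integrable (fun q : (ℝ × A) × B => q.1.1 * h q.1.2 q.2)
      ((P.map fun s => (Z s, Y s)).prod (P.map W)) := by
    rw [← hmap]
    exact (integrable_map_measure hmeas.aestronglyMeasurable
      (hZY'.prodMk hW).aemeasurable).2 hint
  calc ∫ s, Z s * h (Y s) (W s) ∂P
      = ∫ q, q.1.1 * h q.1.2 q.2 ∂(P.map fun s => ((Z s, Y s), W s)) :=
        (integral_map (hZY'.prodMk hW).aemeasurable hmeas.aestronglyMeasurable).symm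
    _ = ∫ a, ∫ b, a.1 * h a.2 b ∂(P.map W) ∂(P.map fun s => (Z s, Y s)) := by
        rw [hmap, integral_prod _ hint']
    _ = ∫ s, ∫ b, Z s * h (Y s) b ∂(P.map W) ∂P :=
        integral_map hZY'.aemeasurable
          hmeas.stronglyMeasurable.integral_prod_right'.aestronglyMeasurable
    _ = ∫ s, 0 ∂P := by
        refine integral_congr_ae (Filter.Eventually.of_forall fun s => ?_)
        dsimp only
        rw [integral_const_mul, integral_map hW.aemeasurable
          (hsec s).aestronglyMeasurable, h0 s, mul_zero]
    _ = 0 := integral_zero _ _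

end FreshRandomness
-- Measurability of prox-steps
section ProxMapping

variable {d : ℕ} {U : Set (Vec d)} {p : Seminorm ℝ (Vec d)} {φ : Vec d → ℝ}
  {gφ : Vec d → Vec d} {Ω : Type*} [MeasurableSpace Ω]

lemma measurable_smul_sum_smul {ι : Type*} (b : ℝ) (s : Finset ι) (c : ι → ℝ)
    {v : ι → Ω → Vec d} (h : ∀ i ∈ s, Measurable (v i)) :
    Measurable fun ω => b • ∑ i ∈ s, c i • v i ω := by
  have h1 : Measurable fun ω => ∑ i ∈ s, c i • v i ω :=
    Finset.measurable_fun_sum _ fun i hi => by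
      have := (h i hi).const_smul (c i)
      exact this
  exact h1.const_smul b

/-- A function that depends on a measurable vector in a Lipschitz way is measurable. -/
lemma measurable_of_norm_sub_le {c v : Ω → Vec d} (hc : Measurable c) {K : ℝ} (hK : 0 ≤ K)
    (h : ∀ s r, ‖v s - v r‖ ≤ K * ‖c s - c r‖) : Measurable v := by
  have hfac : Function.FactorsThrough v c := fun s r hsr => by
    have := h s r
    rw [hsr, sub_self, norm_zero, mul_zero] at this
    exact sub_eq_zero.1 (norm_le_zero_iff.1 this)
  -- The range of `c` need not be measurable; the Lipschitz map on it is therefore extended to all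
  -- of ℝ^d.
  have hlip : LipschitzOnWith ⟨K, hK⟩ (Function.extend c v 0) (Set.range c) := by
    refine LipschitzOnWith.of_dist_le_mul ?_
    rintro _ ⟨s, rfl⟩ _ ⟨r, rfl⟩
    rw [hfac.extend_apply, hfac.extend_apply, dist_eq_norm, dist_eq_norm]
    exact h s r
  obtain ⟨g, hg, hgs⟩ := hlip.extend_finite_dimension
  have : v = g ∘ c := by
    ext1 s
    rw [Function.comp_apply, ← hgs ⟨s, rfl⟩, hfac.extend_apply]
  rw [this]
  exact hg.continuous.measurable.comp hc

lemma IsDistanceGenerating.measurable_gradient_comp (hφ : IsDistanceGenerating U p φ gφ)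
    {v : Ω → Vec d} (hv : Measurable v) (hvU : ∀ s, v s ∈ U) :
    Measurable fun s => gφ (v s) :=
  (continuousOn_iff_continuous_domRestrict.1 hφ.continuousOn_gradient).measurable.comp
    (hv.subtype_mk (h := hvU))

/-- The result of a prox-mapping step is a measurable function of its data. -/
lemma IsDistanceGenerating.measurable_step (hφ : IsDistanceGenerating U p φ gφ)
    (hp : ∀ x, p x = 0 → x = 0) (hU : Convex ℝ U) {a b : ℝ} (ha : 0 < a) (hb : 0 ≤ b)
    {w x q v : Ω → Vec d} (hw : Measurable w) (hx : Measurable x) (hq : Measurable q)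
    (hxU : ∀ s, x s ∈ U) (hqU : ∀ s, q s ∈ U) (hvU : ∀ s, v s ∈ U)
    (hmin : ∀ s, IsMinOn (fun z => inner ℝ (w s) z + a * prox φ gφ (x s) z
      + b * prox φ gφ (q s) z) U (v s)) : Measurable v := by
  obtain ⟨C, hC, hle⟩ := exists_norm_le_mul p hp
  have hc : Measurable fun s => w s - a • gφ (x s) - b • gφ (q s) :=
    (hw.sub ((hφ.measurable_gradient_comp hx hxU).const_smul a)).sub
      ((hφ.measurable_gradient_comp hq hqU).const_smul b)
  -- Each of the two variational inequalities is tested at the other minimizer. Their sum and strong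
  -- convexity give (a + b) p(Δ)^2 ≤ ‖cs - cr‖ ‖Δ‖; one factor C per Euclidean norm gives C^2/a.
  refine measurable_of_norm_sub_le hc (K := C ^ 2 / a) (by positivity) fun s r => ?_
  have h1 := hφ.variational hU (hvU s) (hvU r) (hmin s)
  have h2 := hφ.variational hU (hvU r) (hvU s) (hmin r)
  have h3 := hφ.strongly_convex _ (hvU s) _ (hvU r)
  set Δ := v s - v r with hΔ
  have e1 : v r - v s = -Δ := by rw [hΔ, neg_sub]
  set cs := w s - a • gφ (x s) - b • gφ (q s) with hcs
  set cr := w r - a • gφ (x r) - b • gφ (q r) with hcr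
  have e2 : w s + a • (gφ (v s) - gφ (x s)) + b • (gφ (v s) - gφ (q s))
      = cs + (a + b) • gφ (v s) := by rw [hcs]; module
  have e3 : w r + a • (gφ (v r) - gφ (x r)) + b • (gφ (v r) - gφ (q r))
      = cr + (a + b) • gφ (v r) := by rw [hcr]; module
  rw [e1, e2, inner_neg_right, inner_add_left, inner_smul_left] at h1
  rw [e3, inner_add_left, inner_smul_left] at h2
  rw [inner_sub_left] at h3
  simp only [conj_trivial] at h1 h2
  have h4 : (a + b) * p Δ ^ 2 ≤ ‖cs - cr‖ * ‖Δ‖ := by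
    have h5 := abs_le.1 (abs_real_inner_le_norm (cs - cr) Δ)
    have h6 := mul_le_mul_of_nonneg_left h3 (by positivity : 0 ≤ a + b)
    rw [inner_sub_left] at h5
    linarith [h5.1]
  have h5 : a * p Δ ^ 2 ≤ ‖cs - cr‖ * ‖Δ‖ :=
    le_trans (by nlinarith [sq_nonneg (p Δ)]) h4
  have h6 : ‖Δ‖ ^ 2 ≤ C ^ 2 * p Δ ^ 2 := by
    rw [← mul_pow]
    exact pow_le_pow_left₀ (norm_nonneg _) (hle Δ) 2
  rcases (norm_nonneg Δ).eq_or_lt with h0 | h0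
  · rw [← h0]; positivity
  · have h7 : a * ‖Δ‖ * ‖Δ‖ ≤ C ^ 2 * ‖cs - cr‖ * ‖Δ‖ := by
      have h8 := mul_le_mul_of_nonneg_left h5 (sq_nonneg C)
      have h9 := mul_le_mul_of_nonneg_left h6 ha.le
      nlinarith
    rw [div_mul_eq_mul_div, le_div_iff₀ ha, mul_comm]
    exact le_of_mul_le_mul_right h7 h0

end ProxMapping

/-! ### Adaptedness of the iterates -/

section Past

variable {m : ℕ} {Ω : Type*} {Ξ : Fin m → Type*} [∀ i, MeasurableSpace (Ξ i)]
  {ξ : ∀ i : Fin m, ℕ → ℕ → Ω → Ξ i} {T : ℕ → ℕ}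

lemma past_mono {k t k' t' : ℕ} (h : k < k' ∨ (k = k' ∧ t ≤ t')) :
    past ξ T k t ≤ past ξ T k' t' := by
  refine iSup_le fun j => iSup_le fun a => iSup_le fun b => iSup_le fun hab => ?_
  refine le_iSup_of_le j (le_iSup_of_le a (le_iSup_of_le b (le_iSup_of_le ⟨hab.1, ?_⟩ le_rfl)))
  omega

lemma past_le [mΩ : MeasurableSpace Ω] (hξ : ∀ i k t, Measurable (ξ i k t)) (k t : ℕ) :
    past ξ T k t ≤ mΩ :=
  iSup_le fun j => iSup_le fun a => iSup_le fun b => iSup_le fun _ => (hξ j a b).comap_le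

lemma measurable_input_past {i : Fin m} {k t : ℕ} (hk : 1 ≤ k) (ht : t < T k) :
    Measurable[past ξ T k (t + 1)] (ξ i k t) := by
  refine measurable_iff_comap_le.2 ?_
  exact le_iSup_of_le i (le_iSup_of_le k (le_iSup_of_le t
    (le_iSup_of_le ⟨⟨hk, ht⟩, Or.inr ⟨rfl, by omega⟩⟩ le_rfl)))

variable {d : ℕ} {Γ : SimpleGraph (Fin m)} [DecidableRel Γ.Adj]
  {X : Fin m → Set (Vec d)} {p : Fin m → Seminorm ℝ (Vec d)}
  {φ : Fin m → Vec d → ℝ} {gφ : Fin m → Vec d → Vec d}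
  {α η τ : ℕ → ℝ} {lam β : ℕ → ℝ} {N : ℕ} {G : ∀ i : Fin m, Vec d → Ξ i → Vec d}
  {x0 y0 : Stack m d} {x xhat y : ℕ → Ω → Stack m d} {u : Fin m → ℕ → ℕ → Ω → Vec d}

/-- The inner iterates of an outer iteration are adapted, if its input data are. -/
lemma measurable_inner (hp : ∀ i x, p i x = 0 → x = 0) (hX : ∀ i, Convex ℝ (X i))
    (hφ : ∀ i, IsDistanceGenerating (X i) (p i) (φ i) (gφ i))
    (hG : ∀ i, Measurable (Function.uncurry (G i)))
    (hT : ∀ k < N, 1 ≤ T (k + 1)) (hη : ∀ k < N, 0 < η (k + 1)) (hβ : ∀ t, 0 ≤ β (t + 1))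
    (hx0 : ∀ i, x0 i ∈ X i)
    (hrun : ∀ s, IsRun Γ X φ gφ α η τ T lam β N (fun i k t z => G i z (ξ i k t s)) x0 y0
      (fun k => x k s) (fun k => xhat k s) (fun k => y k s) (fun i k t => u i k t s))
    {k : ℕ} (hk : k < N) (i : Fin m)
    (hx : Measurable[past ξ T (k + 1) 0] fun s => x k s i)
    (hw : Measurable[past ξ T (k + 1) 0] fun s => lap Γ (y (k + 1) s) i) :
    ∀ t ≤ T (k + 1), Measurable[past ξ T (k + 1) t] (u i (k + 1) t) := by
  intro t
  induction t with
  | zero =>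
    intro _
    have : u i (k + 1) 0 = fun s => x k s i := funext fun s => ((hrun s).primal k hk i).init
    rw [this]
    exact hx
  | succ t ih =>
    intro ht
    have hut := (ih (by omega)).mono (past_mono (ξ := ξ) (T := T) (k := k + 1) (k' := k + 1)
      (Or.inr ⟨rfl, Nat.le_succ t⟩)) le_rfl
    have hle : past ξ T (k + 1) 0 ≤ past ξ T (k + 1) (t + 1) :=
      past_mono (Or.inr ⟨rfl, Nat.zero_le _⟩)
    have hξ := measurable_input_past (ξ := ξ) (i := i) (Nat.le_add_left 1 k)
      (show t < T (k + 1) by omega)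
    exact @IsDistanceGenerating.measurable_step d (X i) (p i) (φ i) (gφ i) Ω
      (past ξ T (k + 1) (t + 1)) (hφ i) (hp i) (hX i) (η (k + 1)) (η (k + 1) * β (t + 1))
      (hη k hk) (mul_nonneg (hη k hk).le (hβ t))
      (fun s => lap Γ (y (k + 1) s) i + G i (u i (k + 1) t s) (ξ i (k + 1) t s))
      (fun s => x k s i) (u i (k + 1) t) (u i (k + 1) (t + 1))
      ((hw.mono hle le_rfl).add ((hG i).comp (hut.prodMk hξ)))
      (hx.mono hle le_rfl) hut
      (fun s => (hrun s).x_mem hT hx0 k hk.le i)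
      (fun s => (hrun s).u_mem hT hx0 hk (by omega) i)
      (fun s => (hrun s).u_mem hT hx0 hk ht i)
      (fun s => ((hrun s).primal k hk i).step t (by omega))

lemma measurable_lap [MeasurableSpace Ω] {Y : Ω → Stack m d}
    (h : ∀ i, Measurable fun s => Y s i) (i : Fin m) : Measurable fun s => lap Γ (Y s) i := by
  have e : (fun s => lap Γ (Y s) i) = fun s => (1 : ℝ) • ∑ j, Γ.lapMatrix ℝ i j • Y s j :=
    funext fun s => (one_smul ℝ _).symm
  rw [e]
  exact measurable_smul_sum_smul _ _ _ fun j _ => h j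

lemma measurable_dual_step [MeasurableSpace Ω] {k : ℕ}
    (hdual : ∀ s, y (k + 1) s = y k s + (1 / τ (k + 1)) • lap Γ
      (predict α (fun k => x k s) (fun k => xhat k s) k))
    (h1 : ∀ i, Measurable fun s => x k s i) (h2 : ∀ i, Measurable fun s => x (k - 1) s i)
    (h3 : ∀ i, Measurable fun s => xhat k s i) (h4 : ∀ i, Measurable fun s => y k s i)
    (i : Fin m) : Measurable fun s => y (k + 1) s i := by
  have hpred : ∀ j, Measurable fun s =>
      predict α (fun k => x k s) (fun k => xhat k s) k j := by
    intro j
    have e1 : Measurable fun s => xhat k s j - x (k - 1) s j := (h3 j).sub (h2 j)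
    have e2 : Measurable fun s => α (k + 1) • (xhat k s j - x (k - 1) s j) :=
      (measurable_const_smul (α (k + 1))).comp e1
    exact e2.add (h1 j)
  have e3 : Measurable fun s => (1 / τ (k + 1)) •
      lap Γ (predict α (fun k => x k s) (fun k => xhat k s) k) i :=
    (measurable_const_smul (1 / τ (k + 1))).comp (measurable_lap (Γ := Γ) hpred i)
  have e4 : (fun s => y (k + 1) s i) = fun s => y k s i + (1 / τ (k + 1)) •
      lap Γ (predict α (fun k => x k s) (fun k => xhat k s) k) i :=
    funext fun s => by rw [hdual s]; rfl
  rw [e4]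
  exact (h4 i).add e3

/-- All iterates are adapted to the information generated by the oracle calls. -/
lemma measurable_outer (hp : ∀ i x, p i x = 0 → x = 0) (hX : ∀ i, Convex ℝ (X i))
    (hφ : ∀ i, IsDistanceGenerating (X i) (p i) (φ i) (gφ i))
    (hG : ∀ i, Measurable (Function.uncurry (G i)))
    (hT : ∀ k < N, 1 ≤ T (k + 1)) (hη : ∀ k < N, 0 < η (k + 1)) (hβ : ∀ t, 0 ≤ β (t + 1))
    (hx0 : ∀ i, x0 i ∈ X i)
    (hrun : ∀ s, IsRun Γ X φ gφ α η τ T lam β N (fun i k t z => G i z (ξ i k t s)) x0 y0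
      (fun k => x k s) (fun k => xhat k s) (fun k => y k s) (fun i k t => u i k t s)) :
    ∀ k ≤ N, ∀ i, Measurable[past ξ T (k + 1) 0] (fun s => x k s i) ∧
      Measurable[past ξ T (k + 1) 0] (fun s => x (k - 1) s i) ∧
      Measurable[past ξ T (k + 1) 0] (fun s => xhat k s i) ∧
      Measurable[past ξ T (k + 1) 0] (fun s => y k s i) ∧
      (k < N → Measurable[past ξ T (k + 1) 0] (fun s => lap Γ (y (k + 1) s) i)) := by
  -- The induction carries `x (k - 1)` because the prediction reads two earlier iterates. The dual
  -- vector of iteration `k + 1` is known before its inner loop starts, hence the index `(k + 1,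
  -- 0)`.
  intro k
  induction k with
  | zero =>
    intro _
    have ex : ∀ i, (fun s => x 0 s i) = fun _ => x0 i := fun i =>
      funext fun s => by rw [← (hrun s).init_x]
    have eh : ∀ i, (fun s => xhat 0 s i) = fun _ => x0 i := fun i =>
      funext fun s => by rw [← (hrun s).init_hat]
    have ey : ∀ i, (fun s => y 0 s i) = fun _ => y0 i := fun i =>
      funext fun s => by rw [← (hrun s).init_y]
    have h1 : ∀ i, Measurable[past ξ T (0 + 1) 0] (fun s => x 0 s i) := fun i => by
      rw [ex]; exact measurable_const
    have h2 : ∀ i, Measurable[past ξ T (0 + 1) 0] (fun s => xhat 0 s i) := fun i => by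
      rw [eh]; exact measurable_const
    have h3 : ∀ i, Measurable[past ξ T (0 + 1) 0] (fun s => y 0 s i) := fun i => by
      rw [ey]; exact measurable_const
    exact fun i => ⟨h1 i, h1 i, h2 i, h3 i, fun hN =>
      @measurable_lap _ _ _ Γ _ (past ξ T (0 + 1) 0) (y (0 + 1))
        (@measurable_dual_step _ _ _ Γ _ α τ x xhat y (past ξ T (0 + 1) 0) 0
          (fun s => (hrun s).dual 0 hN) h1 h1 h2 h3) i⟩
  | succ k ih =>
    intro hk
    have hkN : k < N := by omega
    have ih' := ih hkN.le
    have hle : ∀ t, past ξ T (k + 1) t ≤ past ξ T (k + 1 + 1) 0 := fun t =>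
      past_mono (Or.inl (Nat.lt_succ_self _))
    have hu : ∀ i, ∀ t ≤ T (k + 1), Measurable[past ξ T (k + 1 + 1) 0] (u i (k + 1) t) :=
      fun i t ht => (measurable_inner hp hX hφ hG hT hη hβ hx0 hrun hkN i (ih' i).1
        ((ih' i).2.2.2.2 hkN) t ht).mono (hle t) le_rfl
    have h1 : ∀ i, Measurable[past ξ T (k + 1 + 1) 0] (fun s => x (k + 1) s i) := fun i => by
      have : (fun s => x (k + 1) s i) = u i (k + 1) (T (k + 1)) :=
        funext fun s => ((hrun s).primal k hkN i).out
      rw [this]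
      exact hu i _ le_rfl
    have h2 : ∀ i, Measurable[past ξ T (k + 1 + 1) 0] (fun s => x (k + 1 - 1) s i) := fun i =>
      (ih' i).1.mono (hle 0) le_rfl
    have h3 : ∀ i, Measurable[past ξ T (k + 1 + 1) 0] (fun s => xhat (k + 1) s i) := fun i => by
      have : (fun s => xhat (k + 1) s i) = fun s => (∑ t ∈ Finset.Icc 1 (T (k + 1)), lam t)⁻¹ •
          ∑ t ∈ Finset.Icc 1 (T (k + 1)), lam t • u i (k + 1) t s :=
        funext fun s => ((hrun s).primal k hkN i).hat
      rw [this]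
      exact @measurable_smul_sum_smul d Ω (past ξ T (k + 1 + 1) 0) _ _ _ lam
        (fun t => u i (k + 1) t) fun t ht => hu i t (Finset.mem_Icc.1 ht).2
    have h4 : ∀ i, Measurable[past ξ T (k + 1 + 1) 0] (fun s => y (k + 1) s i) := fun i =>
      (@measurable_dual_step _ _ _ Γ _ α τ x xhat y (past ξ T (k + 1) 0) k
        (fun s => (hrun s).dual k hkN) (fun i => (ih' i).1) (fun i => (ih' i).2.1) (fun i => (ih' i).2.2.1)
        (fun i => (ih' i).2.2.2.1) i).mono (hle 0) le_rfl
    exact fun i => ⟨h1 i, h2 i, h3 i, h4 i, fun hN =>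
      @measurable_lap _ _ _ Γ _ (past ξ T (k + 1 + 1) 0) (y (k + 1 + 1))
        (@measurable_dual_step _ _ _ Γ _ α τ x xhat y (past ξ T (k + 1 + 1) 0) (k + 1)
          (fun s => (hrun s).dual (k + 1) hN) h1 h2 h3 h4) i⟩

end Past
-- Exponential moments of sums and tail bounds
section Concentration

variable {Ω : Type*} [mΩ : MeasurableSpace Ω] {P : Measure Ω}

/-- Moment generating function of a doubly indexed sum, from conditional one-step bounds. -/
lemma lintegral_exp_sum_sum_le [IsProbabilityMeasure P] {N T : ℕ} (𝓕 : ℕ → ℕ → MeasurableSpace Ω)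
    (hmono : ∀ k t, 𝓕 k t ≤ 𝓕 k (t + 1)) (hnext : ∀ k, 𝓕 k T ≤ 𝓕 (k + 1) 0)
    {E : ℕ → ℕ → Ω → ℝ} {w : ℕ → ℕ → ℝ}
    (hE : ∀ k < N, ∀ t < T, Measurable[𝓕 k (t + 1)] (E k t))
    (hstep : ∀ k < N, ∀ t < T, ∀ Z : Ω → ℝ, Measurable[𝓕 k t] Z → (∀ s, 0 ≤ Z s) →
      ∫⁻ s, ENNReal.ofReal (Z s * Real.exp (E k t s)) ∂P
        ≤ ENNReal.ofReal (Real.exp (w k t)) * ∫⁻ s, ENNReal.ofReal (Z s) ∂P) :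
    ∫⁻ s, ENNReal.ofReal (Real.exp
        (∑ k ∈ Finset.range N, ∑ t ∈ Finset.range T, E k t s)) ∂P
      ≤ ENNReal.ofReal (Real.exp (∑ k ∈ Finset.range N, ∑ t ∈ Finset.range T, w k t)) := by
  -- The arbitrary weight `Z` will be the exponential of all earlier outer iterations, so one-step
  -- bounds chain across the boundaries between iterations.
  have hinner : ∀ k < N, ∀ Z : Ω → ℝ, Measurable[𝓕 k 0] Z → (∀ s, 0 ≤ Z s) → ∀ n ≤ T,
      Measurable[𝓕 k n] (fun s => Z s * Real.exp (∑ t ∈ Finset.range n, E k t s)) ∧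
      ∫⁻ s, ENNReal.ofReal (Z s * Real.exp (∑ t ∈ Finset.range n, E k t s)) ∂P
        ≤ ENNReal.ofReal (Real.exp (∑ t ∈ Finset.range n, w k t))
          * ∫⁻ s, ENNReal.ofReal (Z s) ∂P := by
    intro k hk Z hZ hZ0 n
    induction n with
    | zero => intro _; simpa using hZ
    | succ n ih =>
      intro hn
      obtain ⟨h1, h2⟩ := ih (by omega)
      have hsplit : ∀ s, Z s * Real.exp (∑ t ∈ Finset.range (n + 1), E k t s)
          = Z s * Real.exp (∑ t ∈ Finset.range n, E k t s) * Real.exp (E k n s) := fun s => by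
        rw [Finset.sum_range_succ, Real.exp_add, mul_assoc]
      simp only [hsplit]
      refine ⟨(h1.mono (hmono k n) le_rfl).mul (Real.measurable_exp.comp (hE k hk n hn)), ?_⟩
      refine (hstep k hk n hn _ h1 fun s => mul_nonneg (hZ0 s) (Real.exp_pos _).le).trans ?_
      rw [Finset.sum_range_succ, Real.exp_add, mul_comm (Real.exp _),
        ENNReal.ofReal_mul (Real.exp_pos _).le, mul_assoc]
      gcongr
  have houter : ∀ n ≤ N,
      Measurable[𝓕 n 0] (fun s => Real.exp
        (∑ k ∈ Finset.range n, ∑ t ∈ Finset.range T, E k t s)) ∧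
      ∫⁻ s, ENNReal.ofReal (Real.exp
        (∑ k ∈ Finset.range n, ∑ t ∈ Finset.range T, E k t s)) ∂P
      ≤ ENNReal.ofReal (Real.exp (∑ k ∈ Finset.range n, ∑ t ∈ Finset.range T, w k t)) := by
    intro n
    induction n with
    | zero => intro _; simp
    | succ n ih =>
      intro hn
      obtain ⟨h1, h2⟩ := ih (by omega)
      obtain ⟨h3, h4⟩ := hinner n hn _ h1 (fun s => (Real.exp_pos _).le) T le_rfl
      have hsplit : ∀ s, Real.exp (∑ k ∈ Finset.range (n + 1), ∑ t ∈ Finset.range T, E k t s)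
          = Real.exp (∑ k ∈ Finset.range n, ∑ t ∈ Finset.range T, E k t s)
            * Real.exp (∑ t ∈ Finset.range T, E n t s) := fun s => by
        rw [Finset.sum_range_succ, Real.exp_add]
      simp only [hsplit]
      refine ⟨h3.mono (hnext n) le_rfl, h4.trans ?_⟩
      rw [Finset.sum_range_succ, Real.exp_add, mul_comm (Real.exp _),
        ENNReal.ofReal_mul (Real.exp_pos _).le]
      gcongr
  exact (houter N le_rfl).2

/-- The exponential Markov inequality. -/
lemma measure_le_of_lintegral_exp_le {A : Ω → ℝ} (hA : Measurable A) {W : ℝ}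
    (hle : ∫⁻ s, ENNReal.ofReal (Real.exp (A s)) ∂P ≤ ENNReal.ofReal (Real.exp W)) (c : ℝ) :
    P {s | c ≤ A s} ≤ ENNReal.ofReal (Real.exp (W - c)) := by
  have h1 := meas_ge_le_lintegral_div (μ := P)
    (f := fun s => ENNReal.ofReal (Real.exp (A s))) hA.exp.ennreal_ofReal.aemeasurable
    (ε := ENNReal.ofReal (Real.exp c)) (by simp [Real.exp_pos]) ENNReal.ofReal_ne_top
  have e : {s | ENNReal.ofReal (Real.exp c) ≤ ENNReal.ofReal (Real.exp (A s))}
      = {s | c ≤ A s} := by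
    ext s
    simp [ENNReal.ofReal_le_ofReal_iff (Real.exp_pos _).le]
  rw [e] at h1
  refine h1.trans ?_
  rw [Real.exp_sub, ENNReal.ofReal_div_of_pos (Real.exp_pos c)]
  gcongr

/-- Deviation of an average of (possibly dependent) light-tailed variables. -/
lemma measure_sum_ge_le {ι : Type*} {Q : Finset ι} (hQ : Q.Nonempty) {D : ι → Ω → ℝ}
    (hD : ∀ q ∈ Q, Measurable (D q))
    (htail : ∀ q ∈ Q, ∫⁻ s, ENNReal.ofReal (Real.exp (D q s)) ∂P
      ≤ ENNReal.ofReal (Real.exp 1)) (ζ : ℝ) :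
    P {s | (1 + ζ) * Q.card ≤ ∑ q ∈ Q, D q s} ≤ ENNReal.ofReal (Real.exp (-ζ)) := by
  set n : ℝ := (Q.card : ℝ) with hn
  have hnpos : 0 < n := by rw [hn]; exact_mod_cast hQ.card_pos
  have hmeas : Measurable fun s => n⁻¹ * ∑ q ∈ Q, D q s :=
    (Finset.measurable_fun_sum _ hD).const_mul _
  have hle : ∫⁻ s, ENNReal.ofReal (Real.exp (n⁻¹ * ∑ q ∈ Q, D q s)) ∂P
      ≤ ENNReal.ofReal (Real.exp 1) := by
    have hpt : ∀ s, ENNReal.ofReal (Real.exp (n⁻¹ * ∑ q ∈ Q, D q s))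
        ≤ ENNReal.ofReal n⁻¹ * ∑ q ∈ Q, ENNReal.ofReal (Real.exp (D q s)) := by
      intro s
      rw [← ENNReal.ofReal_sum_of_nonneg fun q _ => (Real.exp_pos _).le,
        ← ENNReal.ofReal_mul (inv_pos.2 hnpos).le]
      refine ENNReal.ofReal_le_ofReal ?_
      have := convexOn_exp.map_sum_le (t := Q) (w := fun _ => n⁻¹)
        (p := fun q => D q s) (fun _ _ => (inv_pos.2 hnpos).le)
        (by simp [← hn, hnpos.ne']) (fun _ _ => Set.mem_univ _)
      simpa [← Finset.mul_sum] using this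
    refine (lintegral_mono hpt).trans ?_
    have hm : ∀ q ∈ Q, Measurable fun s => ENNReal.ofReal (Real.exp (D q s)) :=
      fun q hq => (hD q hq).exp.ennreal_ofReal
    rw [lintegral_const_mul _ (Finset.measurable_fun_sum _ hm), lintegral_finsetSum' _ fun q hq =>
      (hm q hq).aemeasurable]
    calc _ ≤ ENNReal.ofReal n⁻¹ * ∑ q ∈ Q, ENNReal.ofReal (Real.exp 1) := by
          gcongr with q hq
          exact htail q hq
      _ = ENNReal.ofReal (Real.exp 1) := by
          rw [Finset.sum_const, nsmul_eq_mul, ← mul_assoc, ← ENNReal.ofReal_natCast, ← hn,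
            ← ENNReal.ofReal_mul (inv_pos.2 hnpos).le, inv_mul_cancel₀ hnpos.ne']
          simp
  have h1 := measure_le_of_lintegral_exp_le hmeas hle (1 + ζ)
  have e : (1 : ℝ) - (1 + ζ) = -ζ := by ring
  rw [e] at h1
  refine le_trans (measure_mono fun s hs => ?_) h1
  rw [Set.mem_ofPred_eq] at hs ⊢
  rwa [inv_mul_eq_div, le_div_iff₀ hnpos]

end Concentration

/-! ### Oracle errors at adapted query points -/

section Oracle

variable {m d : ℕ} {Ω : Type*} [mΩ : MeasurableSpace Ω] {P : Measure Ω} [IsProbabilityMeasure P]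
  {Ξ : Fin m → Type*} [∀ i, MeasurableSpace (Ξ i)]
  {X : Fin m → Set (Vec d)} {p : Fin m → Seminorm ℝ (Vec d)} {f' : Fin m → Vec d → Vec d}
  {σ : ℝ} {N : ℕ} {T : ℕ → ℕ} {G : ∀ i : Fin m, Vec d → Ξ i → Vec d}
  {ξ : ∀ i : Fin m, ℕ → ℕ → Ω → Ξ i}

/-- On the constraint set the subgradients agree with a measurable function, the expectation of
the oracle output. -/
lemma IsOracle.exists_measurable_subgradient (hG : IsOracle P X p f' σ N T G ξ) (i : Fin m)
    {k t : ℕ} (hk : k ∈ Finset.Icc 1 N) (ht : t < T k) :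
    ∃ g : Vec d → Vec d, Measurable g ∧ ∀ z ∈ X i, g z = f' i z := by
  refine ⟨fun z => ∫ s, G i z (ξ i k t s) ∂P, ?_, fun z hz => hG.unbiased i k hk t ht z hz⟩
  have h : Measurable (Function.uncurry fun z s => G i z (ξ i k t s)) :=
    (hG.measurable_oracle i).comp
      (measurable_fst.prodMk ((hG.measurable_input i k t).comp measurable_snd))
  exact h.stronglyMeasurable.integral_prod_right.measurable

/-- The oracle error at an adapted query point is adapted. -/
lemma IsOracle.measurable_error (hG : IsOracle P X p f' σ N T G ξ) (i : Fin m)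
    {k t : ℕ} (hk : k ∈ Finset.Icc 1 N) (ht : t < T k) {U : Ω → Vec d}
    (hU : Measurable[past ξ T k t] U) (hUX : ∀ s, U s ∈ X i) :
    Measurable[past ξ T k (t + 1)] fun s => G i (U s) (ξ i k t s) - f' i (U s) := by
  obtain ⟨g, hg, hgf⟩ := hG.exists_measurable_subgradient i hk ht
  have hU' : Measurable[past ξ T k (t + 1)] U :=
    hU.mono (past_mono (Or.inr ⟨rfl, Nat.le_succ t⟩)) le_rfl
  have hξ := measurable_input_past (ξ := ξ) (i := i) (Finset.mem_Icc.1 hk).1 ht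
  have e : (fun s => G i (U s) (ξ i k t s) - f' i (U s))
      = fun s => G i (U s) (ξ i k t s) - g (U s) := funext fun s => by rw [hgf _ (hUX s)]
  rw [e]
  exact ((hG.measurable_oracle i).comp (hU'.prodMk hξ)).sub (hg.comp hU')

/-- With the query point frozen by the past, unbiasedness applies to the fresh input. The
subgradient is first replaced by a measurable version so that Fubini is available. -/
lemma IsOracle.centred (hG : IsOracle P X p f' σ N T G ξ) (i : Fin m)
    {k t : ℕ} (hk : k ∈ Finset.Icc 1 N) (ht : t < T k) {U : Ω → Vec d}
    (hU : Measurable[past ξ T k t] U) (hUX : ∀ s, U s ∈ X i) (z : Vec d) {Z : Ω → ℝ}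
    (hZ : Measurable[past ξ T k t] Z)
    (hint : Integrable (fun s => Z s
      * inner ℝ (G i (U s) (ξ i k t s) - f' i (U s)) (z - U s)) P) :
    ∫ s, Z s * inner ℝ (G i (U s) (ξ i k t s) - f' i (U s)) (z - U s) ∂P = 0 := by
  obtain ⟨g, hg, hgf⟩ := hG.exists_measurable_subgradient i hk ht
  have e : (fun s => Z s * inner ℝ (G i (U s) (ξ i k t s) - f' i (U s)) (z - U s))
      = fun s => Z s * (fun y w => inner ℝ (G i y w - g y) (z - y)) (U s) (ξ i k t s) :=
    funext fun s => by dsimp only; rw [hgf _ (hUX s)]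
  rw [e] at hint ⊢
  refine integral_mul_eq_zero_of_indep (past_le hG.measurable_input k t)
    (hG.measurable_input i k t) (hG.indep i k hk t ht) hU hZ
    (h := fun y w => inner ℝ (G i y w - g y) (z - y)) ?_ (fun s => ?_) hint
  · exact ((hG.measurable_oracle i).sub (hg.comp measurable_fst)).inner
      (measurable_const.sub measurable_fst)
  · have hi := hG.integrable i k hk t ht _ (hUX s)
    have hi' : Integrable (fun r => G i (U s) (ξ i k t r) - g (U s)) P :=
      hi.sub (integrable_const _)
    simp only [real_inner_comm (z - U s)]
    rw [integral_inner hi', integral_sub hi (integrable_const _),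
      hG.unbiased i k hk t ht _ (hUX s), hgf _ (hUX s)]
    simp

lemma IsOracle.tail (hG : IsOracle P X p f' σ N T G ξ) (hp : ∀ i x, p i x = 0 → x = 0)
    (i : Fin m) {k t : ℕ} (hk : k ∈ Finset.Icc 1 N) (ht : t < T k) {U : Ω → Vec d}
    (hU : Measurable[past ξ T k t] U) (hUX : ∀ s, U s ∈ X i) {Z : Ω → ℝ}
    (hZ : Measurable[past ξ T k t] Z) :
    ∫⁻ s, ENNReal.ofReal (Z s) * ENNReal.ofReal
        (Real.exp (dualNorm (p i) (G i (U s) (ξ i k t s) - f' i (U s)) ^ 2 / σ ^ 2)) ∂P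
      ≤ ENNReal.ofReal (Real.exp 1) * ∫⁻ s, ENNReal.ofReal (Z s) ∂P := by
  obtain ⟨g, hg, hgf⟩ := hG.exists_measurable_subgradient i hk ht
  have e : (fun s => ENNReal.ofReal (Z s) * ENNReal.ofReal
        (Real.exp (dualNorm (p i) (G i (U s) (ξ i k t s) - f' i (U s)) ^ 2 / σ ^ 2)))
      = fun s => ENNReal.ofReal (Z s) * (fun y w => ENNReal.ofReal
        (Real.exp (dualNorm (p i) (G i y w - g y) ^ 2 / σ ^ 2))) (U s) (ξ i k t s) :=
    funext fun s => by dsimp only; rw [hgf _ (hUX s)]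
  rw [e]
  refine lintegral_mul_le_of_indep (past_le hG.measurable_input k t)
    (hG.measurable_input i k t) (hG.indep i k hk t ht) hU
    (ENNReal.measurable_ofReal.comp hZ) (h := fun y w => ENNReal.ofReal
        (Real.exp (dualNorm (p i) (G i y w - g y) ^ 2 / σ ^ 2))) ?_ fun s => ?_
  · exact ((((measurable_dualNorm (p i) (hp i)).comp
      ((hG.measurable_oracle i).sub (hg.comp measurable_fst))).pow_const 2).div_const
      _).exp.ennreal_ofReal
  · have := hG.light_tail i k hk t ht _ (hUX s)
    rwa [← hgf _ (hUX s)] at this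

end Oracle
-- Choice of constants
section Numerics

lemma sum_range_add_two_sq_le (T : ℕ) :
    ∑ t ∈ Finset.range T, ((t : ℝ) + 2) ^ 2 ≤ ((T : ℝ) + 1) * (T * (T + 3) / 2) := by
  rw [← sum_range_add_two, Finset.mul_sum]
  refine Finset.sum_le_sum fun t ht => ?_
  have : (t : ℝ) + 1 ≤ T := by exact_mod_cast Finset.mem_range.1 ht
  rw [sq]
  exact mul_le_mul_of_nonneg_right (by linarith) (by positivity)

/-- The left side equals 4Nm(M^2 + (1 + ζ)σ^2)/(L(T + 3)); the choice of T bounds Nm(M^2 + σ^2) by T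
L^2 V. -/
lemma mean_error_le {L V M σ m N T S ζ : ℝ} (hL : 0 < L) (hV : 0 < V) (hm : 0 ≤ m) (hN : 0 ≤ N)
    (hT : 1 ≤ T) (hS : S = T * (T + 3) / 2) (hζ : 0 < ζ)
    (hcond : m * (M ^ 2 + σ ^ 2) * N ≤ T * (L ^ 2 * V)) :
    1 / S * (4 / (2 * L) * (N * m * T * M ^ 2 + (1 + ζ) * σ ^ 2 * (N * m * T)))
      ≤ 4 * (1 + ζ) * L * V := by
  have hTpos : 0 < T := by linarith
  have e : 1 / S * (4 / (2 * L) * (N * m * T * M ^ 2 + (1 + ζ) * σ ^ 2 * (N * m * T)))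
      = 4 * (N * m * (M ^ 2 + (1 + ζ) * σ ^ 2)) / (L * (T + 3)) := by
    rw [hS]
    field_simp
  rw [e, div_le_iff₀ (by positivity)]
  have h1 : N * m * (M ^ 2 + (1 + ζ) * σ ^ 2) ≤ (1 + ζ) * (T * (L ^ 2 * V)) := by
    have h2 := mul_le_mul_of_nonneg_left hcond (by positivity : 0 ≤ 1 + ζ)
    have h3 : 0 ≤ N * m * ζ * M ^ 2 := by positivity
    linarith
  have h4 : 0 ≤ (1 + ζ) * L ^ 2 * V := by positivity
  linarith

/-- This `γ` minimizes γ^2 W - γ c, with minimum -c^2/(4W). The lower bound on T reduces the claim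
to T(T + 1) ≤ 3T(T + 3). -/
lemma chernoff_exponent_le {L V M σ m N T S ζ W c γ : ℝ} (hL : 0 < L) (hV : 0 < V)
    (hσ : 0 < σ) (hm : 0 < m) (hN : 0 < N) (hT : 1 ≤ T) (hS : S = T * (T + 3) / 2)
    (hcond : m * (M ^ 2 + σ ^ 2) * N ≤ T * (L ^ 2 * V))
    (hW : W = 2 * m * σ ^ 2 * V * N * ((T + 1) * S)) (hc : c = 4 * ζ * L * V * S)
    (hγ : γ = c / (2 * W)) : γ ^ 2 * W - γ * c ≤ -ζ ^ 2 / 3 := by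
  have hTpos : 0 < T := by linarith
  have hSpos : 0 < S := by rw [hS]; positivity
  have hWpos : 0 < W := by rw [hW]; positivity
  have e : γ ^ 2 * W - γ * c = -(c ^ 2 / (4 * W)) := by
    rw [hγ]
    field_simp
    ring
  have h1 : ζ ^ 2 / 3 ≤ c ^ 2 / (4 * W) := by
    rw [div_le_div_iff₀ (by norm_num) (by positivity)]
    have h2 : m * σ ^ 2 * N * (T + 1) ≤ 6 * (L ^ 2 * V * S) := by
      have h3 : m * σ ^ 2 * N ≤ T * (L ^ 2 * V) := by
        have : 0 ≤ m * M ^ 2 * N := by positivity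
        linarith
      have h4 := mul_le_mul_of_nonneg_right h3 (by positivity : 0 ≤ T + 1)
      have h5 : 0 ≤ T * T * (L ^ 2 * V) := by positivity
      have h6 : 0 ≤ T * (L ^ 2 * V) := by positivity
      rw [hS]
      nlinarith
    have h3 := mul_le_mul_of_nonneg_left h2 (by positivity : 0 ≤ 8 * ζ ^ 2 * V * S)
    rw [hW, hc]
    linarith
  rw [e]
  linarith

end Numerics

/-! ### The exceptional event and the gap bound -/

section HighProbability

variable {m d : ℕ} {Γ : SimpleGraph (Fin m)} [DecidableRel Γ.Adj]
  {X : Fin m → Set (Vec d)} {p : Fin m → Seminorm ℝ (Vec d)}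
  {f : Fin m → Vec d → ℝ}

lemma obj_average_le (hX : ∀ i, Convex ℝ (X i)) (hf : ∀ i, ConvexOn ℝ (X i) (f i)) {N : ℕ}
    (hN : 1 ≤ N) {z : ℕ → Stack m d} (hz : ∀ k < N, ∀ i, z (k + 1) i ∈ X i) :
    (∀ i, ((N : ℝ)⁻¹ • ∑ k ∈ Finset.Icc 1 N, z k) i ∈ X i) ∧
    N * obj f ((N : ℝ)⁻¹ • ∑ k ∈ Finset.Icc 1 N, z k)
      ≤ ∑ k ∈ Finset.range N, obj f (z (k + 1)) := by
  have hN0 : (0 : ℝ) < N := by exact_mod_cast hN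
  have e : ∀ i, ((N : ℝ)⁻¹ • ∑ k ∈ Finset.Icc 1 N, z k) i
      = ∑ k ∈ Finset.range N, (N : ℝ)⁻¹ • z (k + 1) i := by
    intro i
    rw [sum_Icc_one_eq_sum_range, PiLp.smul_apply, WithLp.ofLp_sum, Finset.sum_apply,
      Finset.smul_sum]
  have hw : ∑ k ∈ Finset.range N, (N : ℝ)⁻¹ = 1 := by simp [hN0.ne']
  refine ⟨fun i => ?_, ?_⟩
  · rw [e]
    exact (hX i).sum_mem (fun _ _ => (inv_pos.2 hN0).le) hw
      fun k hk => hz k (Finset.mem_range.1 hk) i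
  · simp only [obj]
    rw [Finset.sum_comm, Finset.mul_sum]
    refine Finset.sum_le_sum fun i _ => ?_
    rw [e]
    have := (hf i).map_sum_le (t := Finset.range N) (w := fun _ => (N : ℝ)⁻¹)
      (p := fun k => z (k + 1) i) (fun _ _ => (inv_pos.2 hN0).le) hw
      fun k hk => hz k (Finset.mem_range.1 hk) i
    simp only [smul_eq_mul] at this
    rw [← Finset.mul_sum, inv_mul_eq_div, le_div_iff₀ hN0] at this
    linarith

/-- Outside of an event of small probability, the Lagrangian gap of the averaged iterate is
bounded, simultaneously for all dual vectors `Y`. -/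
lemma exists_bad_event (hm : 0 < m)
    (hX : ∀ i, Convex ℝ (X i)) (hp : ∀ i x, p i x = 0 → x = 0)
    {φ : Fin m → Vec d → ℝ} {gφ : Fin m → Vec d → Vec d}
    (hφ : ∀ i, IsDistanceGenerating (X i) (p i) (φ i) (gφ i))
    {f' : Fin m → Vec d → Vec d} {M : ℝ}
    (hf : ∀ i, ConvexOn ℝ (X i) (f i))
    (hsub : ∀ i, ∀ x ∈ X i, ∀ y ∈ X i, 0 ≤ f i x - f i y - inner ℝ (f' i y) (x - y))
    (hupper : ∀ i, ∀ x ∈ X i, ∀ y ∈ X i,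
      f i x - f i y - inner ℝ (f' i y) (x - y) ≤ M * p i (x - y))
    {xs : Stack m d} (hxs : ∀ i, xs i ∈ X i) (hfeas : lap Γ xs = 0) {Vbar : Fin m → ℝ}
    (hVbar : ∀ i, ∀ z ∈ X i, prox (φ i) (gφ i) z (xs i) ≤ Vbar i) (hVpos : 0 < ∑ i, Vbar i)
    {σ : ℝ} (hσ : 0 < σ) {N : ℕ} (hN : 1 ≤ N) {α η τ lam β : ℕ → ℝ} {T : ℕ → ℕ}
    {L : ℝ} (hLdef : L = lapNorm Γ p) (hL : 0 < L) (hα : ∀ k < N, α (k + 1) = 1)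
    (hη : ∀ k < N, η (k + 1) = 2 * L) (hτ : ∀ k < N, τ (k + 1) = L)
    {T0 : ℕ} (hT0 : 1 ≤ T0) (hT : ∀ k < N, T (k + 1) = T0)
    (hcond : m * (M ^ 2 + σ ^ 2) * N ≤ T0 * (L ^ 2 * ∑ i, Vbar i))
    (hlam : ∀ t, 1 ≤ t → lam t = (t : ℝ) + 1) (hβ : ∀ t, 1 ≤ t → β t = (t : ℝ) / 2)
    {Ω : Type*} [mΩ : MeasurableSpace Ω] {P : Measure Ω} [IsProbabilityMeasure P]
    {Ξ : Fin m → Type*} [∀ i, MeasurableSpace (Ξ i)]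
    {G : ∀ i : Fin m, Vec d → Ξ i → Vec d} {ξ : ∀ i : Fin m, ℕ → ℕ → Ω → Ξ i}
    (hG : IsOracle P X p f' σ N T G ξ) {x0 y0 : Stack m d} (hx0 : ∀ i, x0 i ∈ X i)
    {x xhat y : ℕ → Ω → Stack m d} {u : Fin m → ℕ → ℕ → Ω → Vec d}
    (hrun : ∀ s, IsRun Γ X φ gφ α η τ T lam β N (fun i k t z => G i z (ξ i k t s)) x0 y0
      (fun k => x k s) (fun k => xhat k s) (fun k => y k s) (fun i k t => u i k t s))
    {ζ : ℝ} (hζ : 0 < ζ) :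
    ∃ bad : Set Ω, P bad ≤ ENNReal.ofReal (Real.exp (-ζ ^ 2 / 3) + Real.exp (-ζ)) ∧
      ∀ s ∉ bad, ∀ Y : Stack m d,
        N * (obj f ((N : ℝ)⁻¹ • ∑ k ∈ Finset.Icc 1 N, xhat k s) - obj f xs
          + inner ℝ (lap Γ ((N : ℝ)⁻¹ • ∑ k ∈ Finset.Icc 1 N, xhat k s)) Y)
        < L / 2 * ‖Y - y0‖ ^ 2 + (7 + 8 * ζ) * (L * ∑ i, Vbar i) := by
  have : Nonempty (Fin m) := ⟨⟨0, hm⟩⟩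
  set V := ∑ i, Vbar i with hVdef
  have hV0 : ∀ i, 0 ≤ Vbar i := fun i =>
    (hφ i).prox_nonneg (hX i) (hx0 i) (hxs i) |>.trans (hVbar i _ (hx0 i))
  have hT1 : ∀ k < N, 1 ≤ T (k + 1) := fun k hk => by rw [hT k hk]; exact hT0
  have hkI : ∀ k < N, k + 1 ∈ Finset.Icc 1 N := fun k hk => Finset.mem_Icc.2 ⟨by omega, hk⟩
  have hηpos : ∀ k < N, 0 < η (k + 1) := fun k hk => by rw [hη k hk]; positivity
  have hβ0 : ∀ t, 0 ≤ β (t + 1) := fun t => by rw [hβ _ (by omega)]; positivity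
  have hu : ∀ k < N, ∀ t ≤ T0, ∀ i, Measurable[past ξ T (k + 1) t] (u i (k + 1) t) := by
    intro k hk t ht i
    have h := measurable_outer hp hX hφ hG.measurable_oracle hT1 hηpos hβ0 hx0 hrun k hk.le i
    exact measurable_inner hp hX hφ hG.measurable_oracle hT1 hηpos hβ0 hx0 hrun hk i h.1
      (h.2.2.2.2 hk) t (by rw [hT k hk]; exact ht)
  have huX : ∀ k < N, ∀ t ≤ T0, ∀ i s, u i (k + 1) t s ∈ X i := fun k hk t ht i s =>
    (hrun s).u_mem hT1 hx0 hk (by rw [hT k hk]; exact ht) i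
  have htT : ∀ k < N, ∀ t < T0, t < T (k + 1) := fun k hk t ht => by rw [hT k hk]; exact ht
  let δ : Fin m → ℕ → ℕ → Ω → Vec d := fun i k t s =>
    G i (u i (k + 1) t s) (ξ i (k + 1) t s) - f' i (u i (k + 1) t s)
  let Δ : Fin m → ℕ → ℕ → Ω → ℝ := fun i k t s =>
    inner ℝ (δ i k t s) (xs i - u i (k + 1) t s)
  let D : Fin m → ℕ → ℕ → Ω → ℝ := fun i k t s => dualNorm (p i) (δ i k t s) ^ 2 / σ ^ 2
  have hδm : ∀ i, ∀ k < N, ∀ t < T0, Measurable[past ξ T (k + 1) (t + 1)] (δ i k t) :=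
    fun i k hk t ht => hG.measurable_error i (hkI k hk) (htT k hk t ht) (hu k hk t ht.le i)
      (huX k hk t ht.le i)
  have hle : ∀ k t, past ξ T k t ≤ mΩ := past_le hG.measurable_input
  have hΔm : ∀ i, ∀ k < N, ∀ t < T0, Measurable[past ξ T (k + 1) (t + 1)] (Δ i k t) :=
    fun i k hk t ht => by
      have h1 := (hu k hk t ht.le i).mono (past_mono (ξ := ξ) (T := T) (k := k + 1) (t := t)
        (k' := k + 1) (t' := t + 1) (Or.inr ⟨rfl, Nat.le_succ t⟩)) le_rfl
      exact (hδm i k hk t ht).inner (measurable_const.sub h1)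
  have hDm : ∀ i, ∀ k < N, ∀ t < T0, Measurable (D i k t) := fun i k hk t ht =>
    (((measurable_dualNorm (p i) (hp i)).comp
      ((hδm i k hk t ht).mono (hle _ _) le_rfl)).pow_const 2).div_const _
  -- Strong convexity gives p(x* - u)^2 ≤ 2V(u, x*) ≤ 2 Vbar, so the maximal prox-distance to x*
  -- plays the role of a diameter.
  have hΔD : ∀ i, ∀ k < N, ∀ t < T0, ∀ s,
      Δ i k t s ^ 2 ≤ 2 * Vbar i * σ ^ 2 * D i k t s := by
    intro i k hk t ht s
    have h1 := abs_inner_le_dualNorm_mul (p i) (hp i) (δ i k t s) (xs i - u i (k + 1) t s)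
    have h2 := (hφ i).half_sq_le_prox (hX i) (huX k hk t ht.le i s) (hxs i)
    have h3 := hVbar i _ (huX k hk t ht.le i s)
    have e : 2 * Vbar i * σ ^ 2 * D i k t s = 2 * Vbar i * dualNorm (p i) (δ i k t s) ^ 2 := by
      simp only [D]
      field_simp
    rw [e, ← sq_abs]
    calc |Δ i k t s| ^ 2
        ≤ (dualNorm (p i) (δ i k t s) * p i (xs i - u i (k + 1) t s)) ^ 2 :=
          pow_le_pow_left₀ (abs_nonneg _) h1 2
      _ = p i (xs i - u i (k + 1) t s) ^ 2 * dualNorm (p i) (δ i k t s) ^ 2 := by ring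
      _ ≤ _ := by
          gcongr
          linarith
  set S : ℝ := (T0 : ℝ) * (T0 + 3) / 2 with hS
  have hT0r : (1 : ℝ) ≤ T0 := by exact_mod_cast hT0
  have hmr : (0 : ℝ) < m := by exact_mod_cast hm
  have hNr : (0 : ℝ) < N := by exact_mod_cast hN
  have hSpos : 0 < S := by rw [hS]; positivity
  -- `γ^2 * W` bounds the accumulated sub-Gaussian exponent, and `c` is the threshold that becomes
  -- 4ζLV after division by `S`.
  set W : ℝ := 2 * m * σ ^ 2 * V * N * ((T0 + 1) * S) with hW
  set c : ℝ := 4 * ζ * L * V * S with hc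
  set γ : ℝ := c / (2 * W) with hγ
  have hWpos : 0 < W := by positivity
  have hγpos : 0 < γ := by positivity
  let E : ℕ → ℕ → Ω → ℝ := fun k t s => γ * (t + 2) * ∑ i, Δ i k t s
  have hEm : ∀ k < N, ∀ t < T0, Measurable[past ξ T (k + 1) (t + 1)] (E k t) :=
    fun k hk t ht => (Finset.measurable_fun_sum _ fun i _ => hΔm i k hk t ht).const_mul _
  have hmgf := lintegral_exp_sum_sum_le (P := P) (N := N) (T := T0)
    (fun k t => past ξ T (k + 1) t) (fun k t => past_mono (Or.inr ⟨rfl, Nat.le_succ t⟩))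
    (fun k => past_mono (Or.inl (Nat.lt_succ_self _))) (E := E)
    (w := fun _ t => (γ * (t + 2)) ^ 2 * (Fintype.card (Fin m) * ∑ i, 2 * Vbar i * σ ^ 2))
    hEm fun k hk t ht Z hZ hZ0 => lintegral_mul_exp_sum_le (hZ.mono (hle _ _) le_rfl) hZ0
      (fun i => (hΔm i k hk t ht).mono (hle _ _) le_rfl) (fun i => hDm i k hk t ht)
      (fun i s => by positivity)
      (fun i => mul_nonneg (mul_nonneg zero_le_two (hV0 i)) (sq_nonneg σ))
      (fun i s => hΔD i k hk t ht s)
      (fun i hint => hG.centred i (hkI k hk) (htT k hk t ht) (hu k hk t ht.le i)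
        (huX k hk t ht.le i) (xs i) hZ hint)
      (fun i => hG.tail hp i (hkI k hk) (htT k hk t ht) (hu k hk t ht.le i)
        (huX k hk t ht.le i) hZ) (γ * (t + 2))
  have hWle : ∑ k ∈ Finset.range N, ∑ t ∈ Finset.range T0,
      (γ * ((t : ℝ) + 2)) ^ 2 * (Fintype.card (Fin m) * ∑ i, 2 * Vbar i * σ ^ 2)
      ≤ γ ^ 2 * W := by
    have h1 := sum_range_add_two_sq_le T0
    have e : ∑ k ∈ Finset.range N, ∑ t ∈ Finset.range T0,
        (γ * ((t : ℝ) + 2)) ^ 2 * (Fintype.card (Fin m) * ∑ i, 2 * Vbar i * σ ^ 2)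
        = γ ^ 2 * (2 * m * σ ^ 2 * V * N * ∑ t ∈ Finset.range T0, ((t : ℝ) + 2) ^ 2) := by
      rw [Finset.sum_const, Finset.card_range, nsmul_eq_mul, Fintype.card_fin, ← Finset.sum_mul,
        ← Finset.sum_mul, ← Finset.mul_sum, ← hVdef]
      simp only [mul_pow, ← Finset.mul_sum]
      ring
    rw [e, hW]
    gcongr
  have hA : P {s | γ * c ≤ ∑ k ∈ Finset.range N, ∑ t ∈ Finset.range T0, E k t s}
      ≤ ENNReal.ofReal (Real.exp (-ζ ^ 2 / 3)) := by
    have hAm : Measurable fun s => ∑ k ∈ Finset.range N, ∑ t ∈ Finset.range T0, E k t s :=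
      Finset.measurable_fun_sum _ fun k hk => Finset.measurable_fun_sum _ fun t ht =>
        (hEm k (Finset.mem_range.1 hk) t (Finset.mem_range.1 ht)).mono (hle _ _) le_rfl
    refine (measure_le_of_lintegral_exp_le hAm (hmgf.trans (ENNReal.ofReal_le_ofReal
      (Real.exp_le_exp.2 hWle))) (γ * c)).trans (ENNReal.ofReal_le_ofReal (Real.exp_le_exp.2 ?_))
    exact chernoff_exponent_le hL hVpos hσ hmr hNr hT0r hS hcond hW hc hγ
  let Q : Finset (ℕ × ℕ × Fin m) := Finset.range N ×ˢ Finset.range T0 ×ˢ Finset.univ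
  have hQ : Q.Nonempty := ⟨(0, 0, ⟨0, hm⟩), by simp [Q]; omega⟩
  have hQcard : (Q.card : ℝ) = N * m * T0 := by
    simp [Q, Finset.card_product]
    ring
  have hQmem : ∀ q ∈ Q, q.1 < N ∧ q.2.1 < T0 := fun q hq => by
    simpa [Q] using hq
  have hB := measure_sum_ge_le (P := P) hQ (D := fun q => D q.2.2 q.1 q.2.1)
    (fun q hq => hDm _ _ (hQmem q hq).1 _ (hQmem q hq).2) (fun q hq => by
      obtain ⟨hk, ht⟩ := hQmem q hq
      have := hG.tail hp q.2.2 (hkI _ hk) (htT _ hk _ ht) (hu _ hk _ ht.le q.2.2)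
        (huX _ hk _ ht.le q.2.2) (Z := fun _ => 1) measurable_const
      simpa using this) ζ
  refine ⟨_, (measure_union_le _ _).trans (add_le_add hA hB) |>.trans_eq
    (ENNReal.ofReal_add (Real.exp_pos _).le (Real.exp_pos _).le).symm, fun s hs Y => ?_⟩
  rw [Set.mem_union, not_or, Set.mem_ofPred_eq, Set.mem_ofPred_eq, not_le, not_le] at hs
  obtain ⟨hsA, hsB⟩ := hs
  have hgap := (hrun s).sum_gap_le hp hX hφ hf hsub hupper hlam hβ hLdef hL hα hη hτ hT0 hT hx0
    hxs hfeas hS Y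
  have hA' : ∑ k ∈ Finset.range N, ∑ t ∈ Finset.range T0, ((t : ℝ) + 2) * ∑ i, Δ i k t s < c := by
    have e : ∑ k ∈ Finset.range N, ∑ t ∈ Finset.range T0, E k t s
        = γ * ∑ k ∈ Finset.range N, ∑ t ∈ Finset.range T0, ((t : ℝ) + 2) * ∑ i, Δ i k t s := by
      simp only [E, Finset.mul_sum, mul_assoc]
    rw [e] at hsA
    exact lt_of_mul_lt_mul_left hsA hγpos.le
  have hB' : ∑ k ∈ Finset.range N, ∑ t ∈ Finset.range T0, ∑ i,
      dualNorm (p i) (δ i k t s) ^ 2 < (1 + ζ) * σ ^ 2 * (N * m * T0) := by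
    have e : ∑ q ∈ Q, D q.2.2 q.1 q.2.1 s = (∑ k ∈ Finset.range N, ∑ t ∈ Finset.range T0, ∑ i,
        dualNorm (p i) (δ i k t s) ^ 2) / σ ^ 2 := by
      simp only [Q, Finset.sum_product, D, Finset.sum_div]
    rw [e, hQcard, div_lt_iff₀ (by positivity)] at hsB
    linarith
  have hnoise : ∑ k ∈ Finset.range N, noise p f' M (fun i k t z => G i z (ξ i k t s))
      (fun i k t => u i k t s) xs T0 (2 * L) k
      = ∑ k ∈ Finset.range N, ∑ t ∈ Finset.range T0, ((t : ℝ) + 2) * ∑ i, Δ i k t s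
        + 4 / (2 * L) * (N * m * T0 * M ^ 2 + ∑ k ∈ Finset.range N, ∑ t ∈ Finset.range T0, ∑ i,
          dualNorm (p i) (δ i k t s) ^ 2) := by
    have e1 : ∀ k, noise p f' M (fun i k t z => G i z (ξ i k t s))
        (fun i k t => u i k t s) xs T0 (2 * L) k
        = ∑ t ∈ Finset.range T0, ((t : ℝ) + 2) * ∑ i, Δ i k t s
          + 4 / (2 * L) * (m * T0 * M ^ 2 + ∑ t ∈ Finset.range T0, ∑ i,
            dualNorm (p i) (δ i k t s) ^ 2) := by
      intro k
      rw [noise, Finset.sum_add_distrib, Finset.sum_comm, ← Finset.mul_sum]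
      congr 1
      · exact Finset.sum_congr rfl fun t _ => (Finset.mul_sum _ _ _).symm
      · congr 1
        simp only [Finset.sum_add_distrib]
        rw [Finset.sum_comm (s := Finset.range T0)]
        congr 1
        simp only [Finset.sum_const, Finset.card_range, Finset.card_univ, Fintype.card_fin,
          nsmul_eq_mul]
        ring
    simp only [e1]
    rw [Finset.sum_add_distrib, ← Finset.mul_sum, Finset.sum_add_distrib, Finset.sum_const,
      Finset.card_range, nsmul_eq_mul]
    ring
  have hmean := mean_error_le (M := M) (σ := σ) (ζ := ζ) hL hVpos hmr.le hNr.le hT0r hS hζ hcond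
  have hA'' : 1 / S * ∑ k ∈ Finset.range N, ∑ t ∈ Finset.range T0,
      ((t : ℝ) + 2) * ∑ i, Δ i k t s < 4 * ζ * L * V := by
    rw [one_div_mul_eq_div, div_lt_iff₀ hSpos]
    exact hA'
  have hB'' : 1 / S * (4 / (2 * L) * (N * m * T0 * M ^ 2 + ∑ k ∈ Finset.range N,
      ∑ t ∈ Finset.range T0, ∑ i, dualNorm (p i) (δ i k t s) ^ 2)) ≤ 4 * (1 + ζ) * L * V := by
    refine le_trans ?_ hmean
    gcongr
  -- Since T0 ≥ 1, S ≥ 2 and the factor 2(1 + 1/S) is at most 3.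
  have hprox : 2 * L * (1 + 1 / S) * ∑ i, prox (φ i) (gφ i) (x0 i) (xs i) ≤ 3 * (L * V) := by
    have h1 : ∑ i, prox (φ i) (gφ i) (x0 i) (xs i) ≤ V :=
      Finset.sum_le_sum fun i _ => hVbar i _ (hx0 i)
    have h2 : 1 / S ≤ 1 / 2 := by
      refine one_div_le_one_div_of_le two_pos ?_
      rw [hS]
      nlinarith
    calc _ ≤ 2 * L * (1 + 1 / S) * V := by gcongr
      _ ≤ 2 * L * (1 + 1 / 2) * V := by gcongr
      _ = 3 * (L * V) := by ring
  rw [hnoise, mul_add] at hgap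
  have hxm : ∀ k < N, ∀ i, xhat (k + 1) s i ∈ X i := fun k hk i =>
    ((hrun s).primal k hk i).xhat_mem (hX i) (hT1 k hk) hlam
  have hobj := (obj_average_le hX hf hN (z := fun k => xhat k s) hxm).2
  have hlin : N * inner ℝ (lap Γ ((N : ℝ)⁻¹ • ∑ k ∈ Finset.Icc 1 N, xhat k s)) Y
      = ∑ k ∈ Finset.range N, inner ℝ (lap Γ (xhat (k + 1) s)) Y := by
    rw [lap_smul, inner_smul_left, conj_trivial, ← mul_assoc, mul_inv_cancel₀ hNr.ne', one_mul,
      sum_Icc_one_eq_sum_range, ← lapHom_apply, map_sum, sum_inner]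
    rfl
  rw [Finset.sum_add_distrib, Finset.sum_sub_distrib, Finset.sum_const, Finset.card_range,
    nsmul_eq_mul] at hgap
  rw [mul_add, mul_sub, hlin]
  linarith

end HighProbability
end SDCS

/-! ### The two probability bounds -/

theorem mainTheorem7 {m d : ℕ} (hm : 2 ≤ m)
    -- the network
    (Γ : SimpleGraph (Fin m)) [DecidableRel Γ.Adj] (hΓ : Γ.Connected)
    -- constraint sets, norms, prox-functions
    (X : Fin m → Set (SDCS.Vec d)) (hXclosed : ∀ i, IsClosed (X i))
    (hXconvex : ∀ i, Convex ℝ (X i))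
    (p : Fin m → Seminorm ℝ (SDCS.Vec d)) (hp : ∀ i x, p i x = 0 → x = 0)
    (φ : Fin m → SDCS.Vec d → ℝ) (gφ : Fin m → SDCS.Vec d → SDCS.Vec d)
    (hφ : ∀ i, SDCS.IsDistanceGenerating (X i) (p i) (φ i) (gφ i))
    -- objectives with their subgradients
    (f : Fin m → SDCS.Vec d → ℝ) (f' : Fin m → SDCS.Vec d → SDCS.Vec d) (M : ℝ) (hM : 0 < M)
    (hf : ∀ i, ConvexOn ℝ (X i) (f i))
    (hf_sub : ∀ i, ∀ x ∈ X i, ∀ y ∈ X i, 0 ≤ f i x - f i y - inner ℝ (f' i y) (x - y))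
    (hf_upper : ∀ i, ∀ x ∈ X i, ∀ y ∈ X i,
      f i x - f i y - inner ℝ (f' i y) (x - y) ≤ M * p i (x - y))
    -- an optimal solution, and the maximal prox-distances to it
    (xs : SDCS.Stack m d) (hxs : SDCS.IsOptimal Γ X f xs)
    (Vbar : Fin m → ℝ)
    (hVbar : ∀ i, IsGreatest ((fun z => SDCS.prox (φ i) (gφ i) z (xs i)) '' X i) (Vbar i))
    (hVpos : 0 < ∑ i, Vbar i)
    -- parameters
    (σ : ℝ) (hσ : 0 < σ) (N : ℕ) (hN : 1 ≤ N) (α η τ lam β : ℕ → ℝ) (T : ℕ → ℕ)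
    (hα : ∀ k ∈ Finset.Icc 1 N, α k = 1)
    (hη : ∀ k ∈ Finset.Icc 1 N, η k = 2 * SDCS.lapNorm Γ p)
    (hτ : ∀ k ∈ Finset.Icc 1 N, τ k = SDCS.lapNorm Γ p)
    (hT : ∀ k ∈ Finset.Icc 1 N,
      T k = ⌈(m * (M ^ 2 + σ ^ 2) * N) / (SDCS.lapNorm Γ p ^ 2 * ∑ i, Vbar i)⌉₊)
    (hlam : ∀ t, 1 ≤ t → lam t = (t : ℝ) + 1) (hβ : ∀ t, 1 ≤ t → β t = (t : ℝ) / 2)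
    -- the stochastic oracle
    {Ω : Type*} [MeasurableSpace Ω] (P : Measure Ω) [IsProbabilityMeasure P]
    {Ξ : Fin m → Type*} [∀ i, MeasurableSpace (Ξ i)]
    (G : ∀ i : Fin m, SDCS.Vec d → Ξ i → SDCS.Vec d) (ξ : ∀ i : Fin m, ℕ → ℕ → Ω → Ξ i)
    (hG : SDCS.IsOracle P X p f' σ N T G ξ)
    -- the iterates
    (x0 y0 : SDCS.Stack m d) (hx0 : ∀ i, x0 i ∈ X i)
    (x xhat y : ℕ → Ω → SDCS.Stack m d) (u : Fin m → ℕ → ℕ → Ω → SDCS.Vec d)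
    (hrun : ∀ s, SDCS.IsRun Γ X φ gφ α η τ T lam β N (fun i k t z => G i z (ξ i k t s)) x0 y0
      (fun k => x k s) (fun k => xhat k s) (fun k => y k s) (fun i k t => u i k t s))
    (ζ : ℝ) (hζ : 0 < ζ) :
    P {s | SDCS.lapNorm Γ p / N * ((7 + 8 * ζ) * ∑ i, Vbar i + 1 / 2 * ‖y0‖ ^ 2)
          ≤ SDCS.obj f ((N : ℝ)⁻¹ • ∑ k ∈ Finset.Icc 1 N, xhat k s) - SDCS.obj f xs}
        ≤ ENNReal.ofReal (Real.exp (-ζ ^ 2 / 3) + Real.exp (-ζ)) ∧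
    ∀ ys : SDCS.Stack m d, SDCS.IsSaddle Γ X f xs ys →
      P {s | 18 * SDCS.lapNorm Γ p ^ 2 / N ^ 2
              * ((7 + 8 * ζ) * ∑ i, Vbar i + 2 / 3 * ‖ys - y0‖ ^ 2)
            ≤ ‖SDCS.lap Γ ((N : ℝ)⁻¹ • ∑ k ∈ Finset.Icc 1 N, xhat k s)‖ ^ 2}
        ≤ ENNReal.ofReal (Real.exp (-ζ ^ 2 / 3) + Real.exp (-ζ)) := by
  -- In dimension 0 all prox-distances vanish, against `hVpos`.
  have hd : 0 < d := by
    rcases Nat.eq_zero_or_pos d with rfl | h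
    · exfalso
      refine hVpos.ne' (Finset.sum_eq_zero fun i _ => ?_)
      obtain ⟨z, _, hz⟩ := (hVbar i).1
      rw [← hz, Subsingleton.elim z (xs i)]
      exact SDCS.prox_self _
    · exact h
  have hL : 0 < SDCS.lapNorm Γ p := SDCS.lapNorm_pos Γ hp hm hd hΓ
  have hNr : (0 : ℝ) < N := by exact_mod_cast hN
  have hmr : (0 : ℝ) < m := by exact_mod_cast (by omega : 0 < m)
  have hkI : ∀ k < N, k + 1 ∈ Finset.Icc 1 N := fun k hk => Finset.mem_Icc.2 ⟨by omega, hk⟩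
  set L := SDCS.lapNorm Γ p with hLdef
  set V := ∑ i, Vbar i with hV
  set T0 := ⌈(m * (M ^ 2 + σ ^ 2) * N) / (L ^ 2 * V)⌉₊ with hT0def
  have hT0 : 1 ≤ T0 := Nat.ceil_pos.2 (by positivity)
  have hcond : m * (M ^ 2 + σ ^ 2) * N ≤ T0 * (L ^ 2 * V) :=
    (div_le_iff₀ (by positivity)).1 (Nat.le_ceil _)
  have hTk : ∀ k < N, T (k + 1) = T0 := fun k hk => hT _ (hkI k hk)
  obtain ⟨bad, hbad, hgood⟩ := SDCS.exists_bad_event (by omega) hXconvex hp hφ hf hf_sub hf_upper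
    hxs.mem hxs.feasible (fun i z hz => (hVbar i).2 ⟨z, hz, rfl⟩) hVpos hσ hN hLdef hL
    (fun k hk => hα _ (hkI k hk)) (fun k hk => hη _ (hkI k hk)) (fun k hk => hτ _ (hkI k hk))
    hT0 hTk hcond hlam hβ hG hx0 hrun hζ
  refine ⟨(measure_mono fun s hs => ?_).trans hbad, fun ys hys =>
    (measure_mono fun s hs => ?_).trans hbad⟩ <;> rw [Set.mem_ofPred_eq] at hs <;>
    by_contra hsb
  · have h1 := hgood s hsb 0
    rw [inner_zero_right, add_zero, zero_sub, norm_neg] at h1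
    have h2 := mul_le_mul_of_nonneg_left hs hNr.le
    have e : N * (L / N * ((7 + 8 * ζ) * V + 1 / 2 * ‖y0‖ ^ 2))
        = L * ((7 + 8 * ζ) * V + 1 / 2 * ‖y0‖ ^ 2) := by field_simp
    rw [e] at h2
    linarith
  · set xav := (N : ℝ)⁻¹ • ∑ k ∈ Finset.Icc 1 N, xhat k s
    set v := SDCS.lap Γ xav with hv
    have hxm : ∀ i, xav i ∈ X i := (SDCS.obj_average_le hXconvex hf hN (z := fun k => xhat k s)
      fun k hk i => ((hrun s).primal k hk i).xhat_mem (hXconvex i)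
        (by rw [hTk k hk]; exact hT0) hlam).1
    -- Shifting y* along v = 𝐋 x_av makes the gap contain N/(4L) ‖v‖^2, while the saddle inequality
    -- makes the rest nonnegative. With step N/(4L), the quadratic price of the shift is half of
    -- this gain.
    have h1 := hgood s hsb (ys + (N / (4 * L)) • v)
    have h2 := hys.min xav hxm
    rw [hxs.feasible, inner_zero_left, add_zero] at h2
    rw [inner_add_right, inner_smul_right, real_inner_self_eq_norm_sq] at h1
    -- The weights 4/3 and 4 come from ‖a + b‖^2 ≤ (1 + 1/3)‖a‖^2 + (1 + 3)‖b‖^2; L/2 times 4/3 is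
    -- the coefficient 2L/3 of the claim.
    have h3 : ‖ys + (N / (4 * L)) • v - y0‖ ^ 2
        ≤ 4 / 3 * ‖ys - y0‖ ^ 2 + 4 * ((N / (4 * L)) ^ 2 * ‖v‖ ^ 2) := by
      have e : ys + (N / (4 * L)) • v - y0 = (ys - y0) + (N / (4 * L)) • v := by abel
      have h4 : ‖(ys - y0) + (N / (4 * L)) • v‖ ≤ ‖ys - y0‖ + N / (4 * L) * ‖v‖ := by
        refine (norm_add_le _ _).trans_eq ?_
        rw [norm_smul, Real.norm_of_nonneg (by positivity)]
      have h5 := pow_le_pow_left₀ (norm_nonneg _) h4 2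
      rw [e]
      nlinarith [sq_nonneg (‖ys - y0‖ - 3 * (N / (4 * L) * ‖v‖))]
    have h4 : N * (N / (4 * L) * ‖v‖ ^ 2)
        < L / 2 * (4 / 3 * ‖ys - y0‖ ^ 2 + 4 * ((N / (4 * L)) ^ 2 * ‖v‖ ^ 2))
          + (7 + 8 * ζ) * (L * V) := by
      have h6 := mul_le_mul_of_nonneg_left h3 (by positivity : 0 ≤ L / 2)
      have h7 := mul_le_mul_of_nonneg_left h2 hNr.le
      linarith
    have e1 : L / 2 * (4 * ((N / (4 * L)) ^ 2 * ‖v‖ ^ 2)) = N ^ 2 / (8 * L) * ‖v‖ ^ 2 := by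
      field_simp
      ring
    have e2 : N * (N / (4 * L) * ‖v‖ ^ 2) = 2 * (N ^ 2 / (8 * L) * ‖v‖ ^ 2) := by
      field_simp
      ring
    set R := (7 + 8 * ζ) * V + 2 / 3 * ‖ys - y0‖ ^ 2 with hR
    have hRpos : 0 < R := by positivity
    have h5 : N ^ 2 / (8 * L) * ‖v‖ ^ 2 < L * R := by
      rw [hR]
      linarith
    have h6 := mul_le_mul_of_nonneg_left hs (by positivity : 0 ≤ (N : ℝ) ^ 2 / (8 * L))
    -- The argument yields ‖v‖^2 < 8 L^2 R / N^2, so the stated constant 18 leaves the factor 9/4.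
    have e3 : (N : ℝ) ^ 2 / (8 * L) * (18 * L ^ 2 / N ^ 2 * R) = 9 / 4 * (L * R) := by
      field_simp
      ring
    rw [e3] at h6
    have : 0 < L * R := by positivity
    linarith
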